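/- Let $W$ be a finite-dimensional complex vector space, let $Q$ be a non-degenerate alternating bilinear form on $W$, and let $Sp(W)=Sp(W,Q)$ be the group of linear automorphisms of $W$ preserving $Q$. Let $n\ge 0$ be an integer with $n\le \dim W-1$, let $V=\wedge^n W$, and let $\rho\colon Sp(W)\to \mathrm{Aut}(V)$ be the natural action, $\rho(h)(w_1\wedge\cdots\wedge w_n)=hw_1\wedge\cdots\wedge hw_n$. Suppose that $g\in \mathrm{Aut}(V)$ normalizes the image of $Sp(W)$, i.e. $g\,\rho(Sp(W))\,g^{-1}=\rho(Sp(W))$. Then every linear subspace $U\subseteq V$ that is $Sp(W)$-invariant (i.e. $\rho(h)U\subseteq U$ for all $h\in Sp(W)$) is also $g$-invariant: $gU=U$. -/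

import Mathlib

/-- The symplectic group `Sp(W, Q)`: the linear automorphisms of `W` that preserve the bilinear
form `Q` (which is non-degenerate and alternating where this is used). -/
def symplecticSubgroup {W : Type*} [AddCommGroup W] [Module ℂ W]
    (Q : LinearMap.BilinForm ℂ W) : Subgroup (W ≃ₗ[ℂ] W) where
  carrier := {f | ∀ x y : W, Q (f x) (f y) = Q x y}
  mul_mem' := by
    intro f g hf hg x y
    exact (hf (g x) (g y)).trans (hg x y)
  one_mem' := fun _ _ => rfl
  inv_mem' := by
    intro f hf x y
    have h := hf (f.symm x) (f.symm y)
    rw [f.apply_symm_apply, f.apply_symm_apply] at h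
    exact h.symm

/-- The natural action of `GL(W)` on the `n`-th exterior power, as a group homomorphism
`GL(W) → GL(⋀ⁿ W)`; it satisfies `f (w₁ ∧ ⋯ ∧ wₙ) = f w₁ ∧ ⋯ ∧ f wₙ`. -/
noncomputable def exteriorPowerRep (W : Type*) [AddCommGroup W] [Module ℂ W] (n : ℕ) :
    (W ≃ₗ[ℂ] W) →* (⋀[ℂ]^n W ≃ₗ[ℂ] ⋀[ℂ]^n W) where
  toFun f := LinearEquiv.ofLinearMap
    (exteriorPower.map n (f : W →ₗ[ℂ] W)) (exteriorPower.map n (f.symm : W →ₗ[ℂ] W))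
    (by rw [← exteriorPower.map_comp, LinearEquiv.comp_symm, exteriorPower.map_id])
    (by rw [← exteriorPower.map_comp, LinearEquiv.symm_comp, exteriorPower.map_id])
  map_one' := LinearEquiv.toLinearMap_injective exteriorPower.map_id
  map_mul' f g := LinearEquiv.toLinearMap_injective
    (exteriorPower.map_comp (g : W →ₗ[ℂ] W) (f : W →ₗ[ℂ] W))

/-!
Write `X v` for the square-zero operator by which `w ↦ Q v w • v` acts on `V = ⋀ⁿ W`. The
transvection along `v` acts on `V` as `1 + X v`, so subspaces invariant under the symplectic group
are invariant under the span `𝔤` of all `X v`, the image of the symplectic Lie algebra.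

The trace form of `V` is non-degenerate on `𝔤`, and its Casimir operator commutes with every `g`
normalizing `𝔤`. A simple submodule of `V` is determined by its Casimir eigenvalue: in a symplectic
basis, the monomials of a highest weight vector have, after removal of their hyperbolic pairs, an
upper set of indices; two upper sets are comparable, and the eigenvalue is strictly monotone along
them. Hence `g`, which permutes the simple submodules, fixes each of them. Moreover `V` is
completely reducible: `𝔤` is closed under transposition in the basis of monomials, and a highest
weight vector is not isotropic, since its nonzero coefficients agree up to sign. So `g` preserves
every `𝔤`-invariant subspace.

It remains to see that an automorphism normalizing the group normalizes `𝔤`. It takes `1 + X v` to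
some `1 + Y` with `Y` of square zero, which still normalizes `𝔤`, so bracketing with `Y` preserves
`𝔤`. Subtracting from `Y` its projection to `𝔤` along the trace form leaves an operator that
commutes with `𝔤` and has trace zero on each simple submodule, where it is a scalar; so it is zero.
-/

open LinearMap (trace)
open Module (End Dual Basis)

namespace SymplecticExterior

section InvariantSubmodules

variable {K V : Type*} [Field K] [AddCommGroup V] [Module K V]

/-- A subspace is invariant under a space `𝔤` of endomorphisms if every element of `𝔤` maps it
into itself. -/
def IsInvariant (𝔤 : Submodule K (End K V)) (U : Submodule K V) : Prop :=
  ∀ X ∈ 𝔤, U ∈ X.invtSubmodule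

/-- The simple `𝔤`-submodules of `V`, as minimal nonzero invariant subspaces. -/
def IsSimple (𝔤 : Submodule K (End K V)) : Submodule K V → Prop :=
  Minimal fun U => U ≠ ⊥ ∧ IsInvariant 𝔤 U

/-- Complete reducibility of the action of `𝔤` on `V`. -/
def IsCompletelyReducible (𝔤 : Submodule K (End K V)) : Prop :=
  ∀ U, IsInvariant 𝔤 U → ∃ U', IsInvariant 𝔤 U' ∧ IsCompl U U'

/-- The automorphism `g` of `V` normalizes `𝔤`, that is, `g 𝔤 g⁻¹ = 𝔤`. -/
def Normalizes (g : V ≃ₗ[K] V) (𝔤 : Submodule K (End K V)) : Prop :=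
  ∀ T, g.conj T ∈ 𝔤 ↔ T ∈ 𝔤

variable {𝔤 : Submodule K (End K V)} {U M N : Submodule K V} {g : V ≃ₗ[K] V}

lemma IsInvariant.inf (hM : IsInvariant 𝔤 M) (hN : IsInvariant 𝔤 N) : IsInvariant 𝔤 (M ⊓ N) :=
  fun X hX => Sublattice.inf_mem (hM X hX) (hN X hX)

lemma IsInvariant.sSup {s : Set (Submodule K V)} (hs : ∀ M ∈ s, IsInvariant 𝔤 M) :
    IsInvariant 𝔤 (sSup s) := fun X hX =>
  sSup_le fun M hM => (hs M hM X hX).trans (Submodule.comap_mono (le_sSup hM))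

lemma isInvariant_span {s : Set (End K V)} (hs : ∀ X ∈ s, U ∈ X.invtSubmodule) :
    IsInvariant (Submodule.span K s) U := fun X hX => by
  induction hX using Submodule.span_induction with
  | mem X hX => exact hs X hX
  | zero => exact fun z _ => U.zero_mem
  | add X Y _ _ hX hY => exact fun z hz => U.add_mem (hX hz) (hY hz)
  | smul c X _ hX => exact fun z hz => U.smul_mem c (hX hz)

lemma isInvariant_ker_of_commute {T : End K V} (hT : ∀ X ∈ 𝔤, Commute T X) :
    IsInvariant 𝔤 (LinearMap.ker T) := fun X hX z hz => by
  rw [Submodule.mem_comap, LinearMap.mem_ker, ← End.mul_apply, (hT X hX).eq, End.mul_apply,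
    LinearMap.mem_ker.mp hz, map_zero]

lemma IsSimple.le_of_inf_ne_bot (hM : IsSimple 𝔤 M) (hN : IsInvariant 𝔤 N) (h : M ⊓ N ≠ ⊥) :
    M ≤ N :=
  (hM.le_of_le ⟨h, hM.prop.2.inf hN⟩ inf_le_left).trans inf_le_right

lemma IsSimple.eq_of_inf_ne_bot (hM : IsSimple 𝔤 M) (hN : IsSimple 𝔤 N) (h : M ⊓ N ≠ ⊥) :
    M = N :=
  le_antisymm (hM.le_of_inf_ne_bot hN.prop.2 h)
    (hN.le_of_inf_ne_bot hM.prop.2 (by rwa [inf_comm]))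

lemma exists_isSimple_le [FiniteDimensional K V] (hU : IsInvariant 𝔤 U) (h : U ≠ ⊥) :
    ∃ M ≤ U, IsSimple 𝔤 M :=
  exists_minimal_le_of_wellFoundedLT _ U ⟨h, hU⟩

lemma IsCompletelyReducible.eq_sSup_isSimple [FiniteDimensional K V]
    (h𝔤 : IsCompletelyReducible 𝔤) (hU : IsInvariant 𝔤 U) :
    U = sSup {M | IsSimple 𝔤 M ∧ M ≤ U} := by
  set S := sSup {M | IsSimple 𝔤 M ∧ M ≤ U}
  have hSU : S ≤ U := sSup_le fun M hM => hM.2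
  obtain ⟨S', hS', hcompl⟩ := h𝔤 S (.sSup fun M hM => hM.1.prop.2)
  suffices hbot : U ⊓ S' = ⊥ from
    (eq_of_le_of_inf_le_of_sup_le hSU (by rw [hbot]; exact bot_le)
      (by rw [hcompl.sup_eq_top]; exact le_top)).symm
  by_contra hne
  obtain ⟨M, hM, hMs⟩ := exists_isSimple_le (hU.inf hS') hne
  exact hMs.prop.1 (le_bot_iff.mp (hcompl.inf_eq_bot ▸
    le_inf (le_sSup ⟨hMs, hM.trans inf_le_left⟩) (hM.trans inf_le_right)))

lemma IsInvariant.orthogonal {B : LinearMap.BilinForm K V}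
    (hB : ∀ X ∈ 𝔤, ∃ X' ∈ 𝔤, ∀ y z, B (X' y) z = B y (X z)) (hU : IsInvariant 𝔤 U) :
    IsInvariant 𝔤 (B.orthogonal U) := fun X hX z hz u hu => by
  obtain ⟨X', hX', hadj⟩ := hB X hX
  rw [← hadj]
  exact hz _ (hU _ hX' hu)

lemma isCompletelyReducible_of_bilinForm [FiniteDimensional K V] {B : LinearMap.BilinForm K V}
    (hrefl : B.IsRefl) (hB : ∀ X ∈ 𝔤, ∃ X' ∈ 𝔤, ∀ y z, B (X' y) z = B y (X z))
    (hsimple : ∀ M, IsSimple 𝔤 M → ∃ z ∈ M, B z z ≠ 0) : IsCompletelyReducible 𝔤 := fun U hU => by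
  refine ⟨B.orthogonal U, hU.orthogonal hB, ?_⟩
  rw [LinearMap.BilinForm.isCompl_orthogonal_iff_disjoint hrefl, disjoint_iff]
  by_contra hne
  obtain ⟨M, hM, hMs⟩ := exists_isSimple_le (hU.inf (hU.orthogonal hB)) hne
  obtain ⟨z, hz, hzz⟩ := hsimple M hMs
  exact hzz ((hM hz).2 z (hM hz).1)

lemma Normalizes.symm (hg : Normalizes g 𝔤) : Normalizes g.symm 𝔤 := fun T => by
  rw [← hg, show g.conj (g.symm.conj T) = T from g.conj.apply_symm_apply T]

lemma normalizes_span {s : Set (End K V)} (hs : ∀ X ∈ s, g.conj X ∈ Submodule.span K s)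
    (hs' : ∀ X ∈ s, g.symm.conj X ∈ Submodule.span K s) : Normalizes g (Submodule.span K s) := by
  have hle : Submodule.span K s ≤ (Submodule.span K s).comap (g.conj : End K V →ₗ[K] End K V) :=
    Submodule.span_le.mpr hs
  have hle' : Submodule.span K s ≤
      (Submodule.span K s).comap (g.symm.conj : End K V →ₗ[K] End K V) :=
    Submodule.span_le.mpr hs'
  refine fun T => ⟨fun h => ?_, fun h => hle h⟩
  rw [show T = g.symm.conj (g.conj T) from (g.conj.symm_apply_apply T).symm]
  exact hle' h

lemma IsInvariant.map (hg : Normalizes g 𝔤) (hU : IsInvariant 𝔤 U) :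
    IsInvariant 𝔤 (U.map (g : V →ₗ[K] V)) := by
  rintro X hX _ ⟨z, hz, rfl⟩
  exact ⟨_, hU _ ((hg.symm X).mpr hX) hz, by simp⟩

lemma IsSimple.map (hg : Normalizes g 𝔤) (hM : IsSimple 𝔤 M) :
    IsSimple 𝔤 (M.map (g : V →ₗ[K] V)) := by
  let G := Submodule.orderIsoMapComap g
  change IsSimple 𝔤 (G M)
  refine ⟨⟨(map_eq_bot_iff G).not.mpr hM.prop.1, hM.prop.2.map hg⟩, fun N hN hle => ?_⟩
  have hN' : IsInvariant 𝔤 (G.symm N) := by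
    change IsInvariant 𝔤 (N.comap (g : V →ₗ[K] V))
    rw [Submodule.comap_equiv_eq_map_symm]
    exact hN.2.map hg.symm
  exact G.le_symm_apply.mp
    (hM.le_of_le ⟨(map_eq_bot_iff G.symm).not.mpr hN.1, hN'⟩ (G.symm_apply_le.mpr hle))

end InvariantSubmodules

section TraceForm

variable {K V ι : Type*} [Field K] [AddCommGroup V] [Module K V] [Fintype ι]

/-- The families `Z` and `Z'` in `𝔤` are dual to each other with respect to the trace form of
`V`: every element of `𝔤` is expanded in each of them with its traces against the other as
coefficients. The families need not be linearly independent. -/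
structure IsTraceDual (𝔤 : Submodule K (End K V)) (Z Z' : ι → End K V) : Prop where
  mem_left : ∀ i, Z i ∈ 𝔤
  mem_right : ∀ i, Z' i ∈ 𝔤
  sum_left : ∀ T ∈ 𝔤, ∑ i, trace K V (T * Z' i) • Z i = T
  sum_right : ∀ T ∈ 𝔤, ∑ i, trace K V (T * Z i) • Z' i = T

/-- The Casimir operator of a pair of families of endomorphisms. -/
def casimir (Z Z' : ι → End K V) : End K V := ∑ i, Z i * Z' i

variable {𝔤 : Submodule K (End K V)} {Z Z' : ι → End K V}

/- The Casimir element `∑ i, Z i ⊗ Z' i` represents the trace form of `𝔤`, so it absorbs adjoint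
pairs of endomorphisms of `𝔤`; `μ` is a bilinear map on the tensor square. -/
lemma IsTraceDual.sum_adjoint (h : IsTraceDual 𝔤 Z Z') {α β : End K V → End K V}
    (hα : ∀ T ∈ 𝔤, α T ∈ 𝔤) (hβ : ∀ T ∈ 𝔤, β T ∈ 𝔤)
    (hαβ : ∀ S ∈ 𝔤, ∀ T ∈ 𝔤, trace K V (α S * T) = trace K V (S * β T))
    (μ : End K V →ₗ[K] End K V →ₗ[K] End K V) :
    ∑ i, μ (α (Z i)) (Z' i) = ∑ i, μ (Z i) (β (Z' i)) :=
  calc ∑ i, μ (α (Z i)) (Z' i)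
      = ∑ i, ∑ j, trace K V (Z i * β (Z' j)) • μ (Z j) (Z' i) := by
        refine Finset.sum_congr rfl fun i _ => ?_
        nth_rw 1 [← h.sum_left _ (hα _ (h.mem_left i))]
        simp only [map_sum, map_smul, LinearMap.sum_apply, LinearMap.smul_apply,
          hαβ _ (h.mem_left i) _ (h.mem_right _)]
    _ = ∑ i, μ (Z i) (β (Z' i)) := by
        rw [Finset.sum_comm]
        refine Finset.sum_congr rfl fun j _ => ?_
        nth_rw 2 [← h.sum_right _ (hβ _ (h.mem_right j))]
        simp only [map_sum, map_smul, LinearMap.trace_mul_comm K (Z _)]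

lemma IsTraceDual.conj_casimir (h : IsTraceDual 𝔤 Z Z') {g : V ≃ₗ[K] V}
    (hg : Normalizes g 𝔤) : g.conj (casimir Z Z') = casimir Z Z' := by
  have hmul : ∀ S T : End K V, g.conj (S * T) = g.conj S * g.conj T :=
    fun S T => g.conj_comp T S
  have hsymm : ∀ T : End K V, g.conj (g.symm.conj T) = T := g.conj.apply_symm_apply
  have hsum := h.sum_adjoint (α := g.conj) (β := g.symm.conj) (fun T => (hg T).mpr)
    (fun T => (hg.symm T).mpr)
    (fun S _ T _ => by rw [← LinearMap.trace_conj' (S * _) g, hmul, hsymm])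
    ((LinearMap.mul K (End K V)).compl₂ (g.conj : End K V →ₗ[K] End K V))
  simpa [casimir, hmul, hsymm] using hsum

lemma IsTraceDual.commute_casimir_of_bracket_mem (h : IsTraceDual 𝔤 Z Z') {X : End K V}
    (hX : ∀ T ∈ 𝔤, X * T - T * X ∈ 𝔤) : Commute (casimir Z Z') X := by
  have hsum := h.sum_adjoint (α := fun T => X * T - T * X) (β := fun T => T * X - X * T)
    hX (fun T hT => by simpa using neg_mem (hX T hT)) (fun S _ T _ => ?_)
    (LinearMap.mul K (End K V))
  · simp only [LinearMap.mul_apply', sub_mul, mul_sub, Finset.sum_sub_distrib, mul_assoc] at hsum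
    rw [casimir, commute_iff_eq, Finset.mul_sum, Finset.sum_mul]
    simp only [mul_assoc]
    exact (add_right_cancel (sub_eq_sub_iff_add_eq_add.mp hsum)).symm
  · rw [sub_mul, mul_sub, map_sub, map_sub, mul_assoc, LinearMap.trace_mul_comm, mul_assoc,
      mul_assoc]

lemma trace_bracket_mul (X S T : End K V) :
    trace K V ((X * S - S * X) * T) = trace K V (X * (S * T - T * S)) := by
  rw [sub_mul, mul_sub, map_sub, map_sub, mul_assoc, mul_assoc S, LinearMap.trace_mul_comm K S,
    mul_assoc]

lemma trace_mul_eq_zero_of_commute {X Y : End K V} (hX : IsNilpotent X) (h : Commute X Y) :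
    trace K V (X * Y) = 0 :=
  (LinearMap.isNilpotent_trace_of_isNilpotent (h.isNilpotent_mul_right hX)).eq_zero

/- The trace form represents the functional `T ↦ tr (Y T)` on `𝔤` by some `X ∈ 𝔤`; invariance
of the trace form then makes `[Y - X, T]` orthogonal to `𝔤`. -/
lemma IsTraceDual.exists_commute_sub (h : IsTraceDual 𝔤 Z Z') {Y : End K V}
    (h𝔤 : ∀ S ∈ 𝔤, ∀ T ∈ 𝔤, S * T - T * S ∈ 𝔤) (hY : ∀ T ∈ 𝔤, Y * T - T * Y ∈ 𝔤) :
    ∃ X ∈ 𝔤, ∀ T ∈ 𝔤, Commute (Y - X) T := by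
  set X := ∑ i, trace K V (Y * Z' i) • Z i
  have hX : X ∈ 𝔤 := sum_mem fun i _ => 𝔤.smul_mem _ (h.mem_left i)
  have htrace : ∀ T ∈ 𝔤, trace K V ((Y - X) * T) = 0 := fun T hT => by
    have hXT : trace K V (X * T) = ∑ i, trace K V (Y * Z' i) * trace K V (T * Z i) := by
      simp only [X, Finset.sum_mul, smul_mul_assoc, map_sum, map_smul, smul_eq_mul,
        LinearMap.trace_mul_comm K (Z _)]
    nth_rw 1 [sub_mul, map_sub, hXT, ← h.sum_right T hT]
    simp [Finset.mul_sum, mul_comm]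
  refine ⟨X, hX, fun T hT => sub_eq_zero.mp ?_⟩
  have hmem : (Y - X) * T - T * (Y - X) ∈ 𝔤 := by
    convert sub_mem (hY T hT) (h𝔤 X hX T hT) using 1
    noncomm_ring
  rw [← h.sum_left _ hmem]
  refine Finset.sum_eq_zero fun i _ => ?_
  rw [trace_bracket_mul, htrace _ (h𝔤 T hT _ (h.mem_right i)), zero_smul]

variable {g : V ≃ₗ[K] V} {M N : Submodule K V}

lemma exists_linearEquiv_eq_one_add {Y : End K V} (hY : Y * Y = 0) :
    ∃ g : V ≃ₗ[K] V, (g : End K V) = 1 + Y :=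
  ⟨.ofLinearMap (1 + Y) (1 - Y) (show (1 + Y) * (1 - Y) = 1 by simp [add_mul, mul_sub, hY])
    (show (1 - Y) * (1 + Y) = 1 by simp [mul_add, sub_mul, hY]), rfl⟩

lemma bracket_mem_of_normalizes [CharZero K] {Y : End K V} (hY : Y * Y = 0)
    (hgY : ∀ z, g z = z + Y z) (hg : Normalizes g 𝔤) {T : End K V} (hT : T ∈ 𝔤) :
    Y * T - T * Y ∈ 𝔤 := by
  have hsymm : ∀ z, g.symm z = z - Y z := fun z => by
    rw [g.symm_apply_eq, hgY, map_sub, ← End.mul_apply, hY]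
    simp
  have hconj : g.conj T = (1 + Y) * T * (1 - Y) := by
    ext z
    simp [LinearEquiv.conj_apply, hgY, hsymm]
  have hconj_symm : g.symm.conj T = (1 - Y) * T * (1 + Y) := by
    ext z
    simp [LinearEquiv.conj_apply, hgY, hsymm]
  have hsub : g.conj T - g.symm.conj T ∈ 𝔤 := sub_mem ((hg T).mpr hT) ((hg.symm T).mpr hT)
  have htwo : g.conj T - g.symm.conj T = (2 : K) • (Y * T - T * Y) := by
    rw [hconj, hconj_symm, two_smul]
    noncomm_ring
  rwa [htwo, 𝔤.smul_mem_iff two_ne_zero] at hsub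

lemma commute_projection {T : End K V} (hM : M ∈ T.invtSubmodule) (hN : N ∈ T.invtSubmodule)
    (hMN : IsCompl M N) : Commute T (M.projection N hMN) := by
  refine ((LinearMap.IsIdempotentElem.commute_iff
    (Submodule.isIdempotentElem_projection hMN)).mpr ?_).symm
  rw [Submodule.range_projection, Submodule.ker_projection]
  exact ⟨hM, hN⟩

lemma trace_mul_projection_eq_zero (hnil : 𝔤 ≤ Submodule.span K {X | X ∈ 𝔤 ∧ IsNilpotent X})
    (hM : IsInvariant 𝔤 M) (hN : IsInvariant 𝔤 N) (hMN : IsCompl M N) {X : End K V}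
    (hX : X ∈ 𝔤) : trace K V (X * M.projection N hMN) = 0 := by
  suffices h : 𝔤 ≤ LinearMap.ker (trace K V ∘ₗ LinearMap.mulRight K (M.projection N hMN)) from
    LinearMap.mem_ker.mp (h hX)
  exact hnil.trans <| Submodule.span_le.mpr fun T hT =>
    trace_mul_eq_zero_of_commute hT.2 (commute_projection (hM T hT.1) (hN T hT.1) hMN)

lemma IsSimple.eq_zero_of_trace_eq_zero [CharZero K] [FiniteDimensional K V]
    (hM : IsSimple 𝔤 M) (hMN : IsCompl M N) {S : End K V} {c : K} (hS : ∀ z ∈ M, S z = c • z)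
    (htr : trace K V (S * M.projection N hMN) = 0) : c = 0 := by
  have hproj : LinearMap.IsProj M (M.projection N hMN) :=
    ⟨Submodule.projection_apply_mem hMN, fun _ => Submodule.projection_apply_of_mem_left hMN⟩
  have hSP : S * M.projection N hMN = c • M.projection N hMN :=
    LinearMap.ext fun z => hS _ (hproj.map_mem z)
  have hfinrank : Module.finrank K M ≠ 0 := fun h0 =>
    hM.prop.1 (Submodule.finrank_eq_zero.mp h0)
  rw [hSP, map_smul, hproj.trace, smul_eq_mul, mul_eq_zero] at htr
  exact htr.resolve_right (Nat.cast_ne_zero.mpr hfinrank)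

end TraceForm

section Separation

variable {K V : Type*} [Field K] [IsAlgClosed K] [AddCommGroup V] [Module K V]
  [FiniteDimensional K V] {U : Submodule K V}

lemma exists_eigenvector_mem {T : End K V} (hU : U ∈ T.invtSubmodule) (h : U ≠ ⊥) :
    ∃ c : K, ∃ z ∈ U, z ≠ 0 ∧ T z = c • z := by
  have := Submodule.nontrivial_iff_ne_bot.mpr h
  obtain ⟨c, hc⟩ := End.exists_eigenvalue (T.restrict hU)
  obtain ⟨z, hz⟩ := hc.exists_hasEigenvector
  exact ⟨c, z, z.2, fun h0 => hz.2 (Subtype.ext h0), congrArg Subtype.val hz.apply_eq_smul⟩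

/- Going up from any eigenvalue in steps of one, the last eigenvalue met belongs to such an
eigenvector. -/
lemma exists_eigenvector_mem_forall_raising_eq_zero [CharZero K] {H : End K V}
    (hU : U ∈ H.invtSubmodule) (h : U ≠ ⊥) :
    ∃ z ∈ U, z ≠ 0 ∧ ∀ R : End K V, U ∈ R.invtSubmodule →
      ∀ k : ℕ, 0 < k → H * R - R * H = (k : K) • R → R z = 0 := by
  obtain ⟨c, z, hzU, hz, hcz⟩ := exists_eigenvector_mem hU h
  let P : ℕ → Prop := fun k => ∃ z ∈ U, z ≠ 0 ∧ H z = (c + k) • z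
  have hfin : {k | P k}.Finite := by
    refine Set.Finite.of_finite_image
      ((End.finite_hasEigenvalue H).subset ?_) (f := fun k : ℕ => c + (k : K))
      fun k _ l _ hkl => Nat.cast_injective (add_left_cancel hkl)
    rintro _ ⟨k, ⟨z, -, hz, hk⟩, rfl⟩
    exact End.hasEigenvalue_of_hasEigenvector ⟨End.mem_eigenspace_iff.mpr hk, hz⟩
  obtain ⟨l, ⟨y, hyU, hy, hly⟩, hmax⟩ :=
    Set.exists_max_image _ id hfin ⟨0, z, hzU, hz, by simpa using hcz⟩
  refine ⟨y, hyU, hy, fun R hR k hk hHR => ?_⟩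
  by_contra hRy
  have hstep : P (l + k) := by
    refine ⟨R y, hR hyU, hRy, ?_⟩
    have h1 := LinearMap.congr_fun hHR y
    simp only [LinearMap.sub_apply, End.mul_apply, hly, map_smul, LinearMap.smul_apply] at h1
    rw [sub_eq_iff_eq_add.mp h1, Nat.cast_add]
    module
  have hle : l + k ≤ l := hmax _ hstep
  lia

variable {𝔤 : Submodule K (End K V)} {M : Submodule K V} {C : End K V}

lemma IsSimple.exists_eq_smul {T : End K V} (hM : IsSimple 𝔤 M) (hT : ∀ X ∈ 𝔤, Commute T X)
    (hMT : M ∈ T.invtSubmodule) : ∃ c : K, ∀ z ∈ M, T z = c • z := by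
  obtain ⟨c, z, hzM, hz, hTz⟩ := exists_eigenvector_mem hMT hM.prop.1
  have hker : IsInvariant 𝔤 (LinearMap.ker (T - c • 1)) := isInvariant_ker_of_commute fun X hX =>
    (hT X hX).sub_left ((Commute.one_left X).smul_left c)
  have hmem : ∀ z, z ∈ LinearMap.ker (T - c • 1) ↔ T z = c • z := fun z => by
    simp [sub_eq_zero]
  refine ⟨c, fun y hy => (hmem y).mp (hM.le_of_inf_ne_bot hker ?_ hy)⟩
  exact (Submodule.ne_bot_iff _).mpr ⟨z, ⟨hzM, (hmem z).mpr hTz⟩, hz⟩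

/-- An operator `C` separates the simple `𝔤`-submodules if two of them on which it acts by the
same scalar are equal. In particular no two distinct simple submodules are isomorphic. -/
def SeparatesSimple (𝔤 : Submodule K (End K V)) (C : End K V) : Prop :=
  ∀ M N, IsSimple 𝔤 M → IsSimple 𝔤 N → ∀ c : K, (∀ z ∈ M, C z = c • z) →
    (∀ z ∈ N, C z = c • z) → M = N

variable {ι : Type*} [Fintype ι] {Z Z' : ι → End K V} {g : V ≃ₗ[K] V}

lemma IsTraceDual.exists_casimir_eq_smul (h : IsTraceDual 𝔤 Z Z')
    (h𝔤 : ∀ S ∈ 𝔤, ∀ T ∈ 𝔤, S * T - T * S ∈ 𝔤) (hM : IsSimple 𝔤 M) :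
    ∃ c : K, ∀ z ∈ M, casimir Z Z' z = c • z :=
  hM.exists_eq_smul (fun X hX => h.commute_casimir_of_bracket_mem (h𝔤 X hX)) fun z hz => by
    rw [Submodule.mem_comap, casimir, LinearMap.sum_apply]
    exact sum_mem fun i _ =>
      hM.prop.2 _ (h.mem_left i) (hM.prop.2 _ (h.mem_right i) hz)

lemma IsSimple.map_eq (hM : IsSimple 𝔤 M) (h : IsTraceDual 𝔤 Z Z')
    (h𝔤 : ∀ S ∈ 𝔤, ∀ T ∈ 𝔤, S * T - T * S ∈ 𝔤) (hsep : SeparatesSimple 𝔤 (casimir Z Z'))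
    (hg : Normalizes g 𝔤) : M.map (g : V →ₗ[K] V) = M := by
  obtain ⟨c, hc⟩ := h.exists_casimir_eq_smul h𝔤 hM
  refine hsep _ _ (hM.map hg) hM c ?_ hc
  rintro _ ⟨z, hz, rfl⟩
  rw [← h.conj_casimir hg]
  simp [LinearEquiv.conj_apply, hc z hz]

lemma IsInvariant.map_eq (hU : IsInvariant 𝔤 U) (hred : IsCompletelyReducible 𝔤)
    (h : IsTraceDual 𝔤 Z Z') (h𝔤 : ∀ S ∈ 𝔤, ∀ T ∈ 𝔤, S * T - T * S ∈ 𝔤)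
    (hsep : SeparatesSimple 𝔤 (casimir Z Z')) (hg : Normalizes g 𝔤) :
    U.map (g : V →ₗ[K] V) = U := by
  rw [hred.eq_sSup_isSimple hU, sSup_eq_iSup, Submodule.map_iSup]
  simp only [Submodule.map_iSup]
  exact iSup_congr fun M => iSup_congr fun hM => hM.1.map_eq h h𝔤 hsep hg

lemma IsInvariant.mem_invtSubmodule_of_normalizes (hU : IsInvariant 𝔤 U)
    (hred : IsCompletelyReducible 𝔤) (h : IsTraceDual 𝔤 Z Z')
    (h𝔤 : ∀ S ∈ 𝔤, ∀ T ∈ 𝔤, S * T - T * S ∈ 𝔤) (hsep : SeparatesSimple 𝔤 (casimir Z Z'))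
    (hg : Normalizes g 𝔤) {Y : End K V} (hgY : ∀ z, g z = z + Y z) : U ∈ Y.invtSubmodule :=
  fun z hz => by
    have hgz : g z ∈ U := hU.map_eq hred h h𝔤 hsep hg ▸ Submodule.mem_map_of_mem hz
    rw [hgY] at hgz
    exact (U.add_mem_iff_right hz).mp hgz

/- Write `Y = X + S` with `X ∈ 𝔤` and `S` commuting with `𝔤`. Then `S` acts on each simple
submodule by a scalar, which is zero because `Y` and `X` have trace zero there. -/
theorem mem_of_normalizes [CharZero K] (hred : IsCompletelyReducible 𝔤)
    (h : IsTraceDual 𝔤 Z Z') (h𝔤 : ∀ S ∈ 𝔤, ∀ T ∈ 𝔤, S * T - T * S ∈ 𝔤)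
    (hsep : SeparatesSimple 𝔤 (casimir Z Z'))
    (hnil : 𝔤 ≤ Submodule.span K {X | X ∈ 𝔤 ∧ IsNilpotent X})
    {Y : End K V} (hY : Y * Y = 0) (hgY : ∀ z, g z = z + Y z) (hg : Normalizes g 𝔤) :
    Y ∈ 𝔤 := by
  obtain ⟨X, hX, hcomm⟩ := h.exists_commute_sub h𝔤
    fun T hT => bracket_mem_of_normalizes hY hgY hg hT
  suffices hS : Y - X = 0 from sub_eq_zero.mp hS ▸ hX
  suffices hker : sSup {M | IsSimple 𝔤 M ∧ M ≤ ⊤} ≤ LinearMap.ker (Y - X) by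
    rwa [← hred.eq_sSup_isSimple fun _ _ _ _ => Submodule.mem_top, top_le_iff,
      LinearMap.ker_eq_top] at hker
  refine sSup_le fun M hM => ?_
  obtain ⟨N, hN, hMN⟩ := hred M hM.1.prop.2
  have hinv {U : Submodule K V} (hU : IsInvariant 𝔤 U) : U ∈ Y.invtSubmodule :=
    hU.mem_invtSubmodule_of_normalizes hred h h𝔤 hsep hg hgY
  have htrX : trace K V (X * M.projection N hMN) = 0 :=
    trace_mul_projection_eq_zero hnil hM.1.prop.2 hN hMN hX
  have htrY : trace K V (Y * M.projection N hMN) = 0 :=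
    trace_mul_eq_zero_of_commute ⟨2, by rw [pow_two, hY]⟩
      (commute_projection (hinv hM.1.prop.2) (hinv hN) hMN)
  obtain ⟨c, hc⟩ := hM.1.exists_eq_smul hcomm fun z hz =>
    M.sub_mem (hinv hM.1.prop.2 hz) (hM.1.prop.2 X hX hz)
  have hc0 : c = 0 := hM.1.eq_zero_of_trace_eq_zero hMN hc
    (by rw [sub_mul, map_sub, htrX, htrY, sub_zero])
  exact fun z hz => by rw [LinearMap.mem_ker, hc z hz, hc0, zero_smul]

end Separation

section SymplecticAction

variable {K W V : Type*} [Field K] [AddCommGroup W] [Module K W] [AddCommGroup V] [Module K V]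

/-- A linear action `D` on `V` of the rank one endomorphisms `φ(·) v` of `W` that respects
commutators, and in which those of square zero act by operators of square zero. -/
structure IsRankOneAction (D : W →ₗ[K] Dual K W →ₗ[K] End K V) : Prop where
  commutator : ∀ v φ w ψ, D v φ * D w ψ - D w ψ * D v φ = φ w • D v ψ - ψ v • D w φ
  sq_eq_zero : ∀ v φ, φ v = 0 → D v φ * D v φ = 0

/-- The action of the symmetric product `a b`, regarded as the element
`x ↦ Q(b, x) a + Q(a, x) b` of the symplectic Lie algebra. -/
def symAction (D : W →ₗ[K] Dual K W →ₗ[K] End K V) (Q : LinearMap.BilinForm K W) :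
    W →ₗ[K] W →ₗ[K] End K V :=
  D.compl₂ Q + (D.compl₂ Q).flip

/-- The action of the nilpotent endomorphism `x ↦ Q(v, x) v`; these span the symplectic Lie
algebra. -/
def sqAction (D : W →ₗ[K] Dual K W →ₗ[K] End K V) (Q : LinearMap.BilinForm K W) (v : W) :
    End K V :=
  D v (Q v)

/-- The image in `End V` of the symplectic Lie algebra of `Q`. -/
def symplecticAlgebra (D : W →ₗ[K] Dual K W →ₗ[K] End K V) (Q : LinearMap.BilinForm K W) :
    Submodule K (End K V) :=
  Submodule.span K (Set.range (sqAction D Q))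

variable {D : W →ₗ[K] Dual K W →ₗ[K] End K V} {Q : LinearMap.BilinForm K W}

lemma symAction_apply (a b : W) : symAction D Q a b = D a (Q b) + D b (Q a) := rfl

lemma symAction_self (v : W) : symAction D Q v v = (2 : K) • sqAction D Q v :=
  (two_smul K _).symm

lemma sqAction_add (v w : W) :
    sqAction D Q (v + w) = sqAction D Q v + sqAction D Q w + symAction D Q v w := by
  simp only [sqAction, symAction_apply, map_add, LinearMap.add_apply]
  abel

lemma sqAction_smul (c : K) (v : W) : sqAction D Q (c • v) = c ^ 2 • sqAction D Q v := by
  simp [sqAction, smul_smul, pow_two]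

lemma sqAction_mem (v : W) : sqAction D Q v ∈ symplecticAlgebra D Q :=
  Submodule.subset_span ⟨v, rfl⟩

lemma symAction_mem (a b : W) : symAction D Q a b ∈ symplecticAlgebra D Q := by
  rw [← add_sub_cancel_left (sqAction D Q a + sqAction D Q b) (symAction D Q a b), ← sqAction_add]
  exact sub_mem (sqAction_mem _) (add_mem (sqAction_mem _) (sqAction_mem _))

namespace IsRankOneAction

lemma symAction_bracket_sqAction (hD : IsRankOneAction D) (hQ : Q.IsAlt) (a b w : W) :
    symAction D Q a b * sqAction D Q w - sqAction D Q w * symAction D Q a b =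
      Q b w • symAction D Q a w + Q a w • symAction D Q b w := by
  have h1 := hD.commutator a (Q b) w (Q w)
  have h2 := hD.commutator b (Q a) w (Q w)
  rw [← LinearMap.IsAlt.neg hQ a w] at h1
  rw [← LinearMap.IsAlt.neg hQ b w] at h2
  simp only [symAction_apply, sqAction, add_mul, mul_add]
  linear_combination (norm := module) h1 + h2

lemma sqAction_bracket (hD : IsRankOneAction D) (hQ : Q.IsAlt) (v w : W) :
    sqAction D Q v * sqAction D Q w - sqAction D Q w * sqAction D Q v =
      Q v w • symAction D Q v w := by
  rw [sqAction, sqAction, hD.commutator, ← LinearMap.IsAlt.neg hQ v w, neg_smul, sub_neg_eq_add,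
    ← smul_add, symAction_apply]

lemma isNilpotent_sqAction (hD : IsRankOneAction D) (hQ : Q.IsAlt) (v : W) :
    IsNilpotent (sqAction D Q v) :=
  ⟨2, by rw [pow_two]; exact hD.sq_eq_zero v (Q v) (hQ v)⟩

lemma symplecticAlgebra_le_span_nilpotent (hD : IsRankOneAction D) (hQ : Q.IsAlt) :
    symplecticAlgebra D Q ≤ Submodule.span K {X | X ∈ symplecticAlgebra D Q ∧ IsNilpotent X} :=
  Submodule.span_mono <| Set.range_subset_iff.mpr fun v =>
    ⟨sqAction_mem v, hD.isNilpotent_sqAction hQ v⟩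

lemma bracket_mem (hD : IsRankOneAction D) (hQ : Q.IsAlt) :
    ∀ S ∈ symplecticAlgebra D Q, ∀ T ∈ symplecticAlgebra D Q,
      S * T - T * S ∈ symplecticAlgebra D Q := fun S hS T hT => by
  let bracket : End K V →ₗ[K] End K V →ₗ[K] End K V :=
    LinearMap.mul K (End K V) - (LinearMap.mul K (End K V)).flip
  change bracket S T ∈ _
  induction hS, hT using Submodule.span_induction₂ with
  | mem_mem X Y hX hY =>
    obtain ⟨⟨v, rfl⟩, ⟨w, rfl⟩⟩ := hX, hY
    change sqAction D Q v * sqAction D Q w - sqAction D Q w * sqAction D Q v ∈ _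
    rw [hD.sqAction_bracket hQ]
    exact Submodule.smul_mem _ _ (symAction_mem v w)
  | zero_left Y _ => simp
  | zero_right X _ => simp
  | add_left X X' Y _ _ _ h h' => rw [map_add]; exact add_mem h h'
  | add_right X Y Y' _ _ _ h h' => rw [map_add]; exact add_mem h h'
  | smul_left c X Y _ _ h => rw [map_smul]; exact Submodule.smul_mem _ c h
  | smul_right c X Y _ _ h => rw [map_smul]; exact Submodule.smul_mem _ c h

lemma trace_sqAction_mul_eq_zero (hD : IsRankOneAction D) (hQ : Q.IsAlt) {v w : W}
    (h : Q v w = 0) : trace K V (sqAction D Q v * sqAction D Q w) = 0 :=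
  trace_mul_eq_zero_of_commute (hD.isNilpotent_sqAction hQ v) <| sub_eq_zero.mp <| by
    rw [hD.sqAction_bracket hQ, h, zero_smul]

lemma trace_sqAction_mul_symAction_self (hD : IsRankOneAction D) (hQ : Q.IsAlt) {v w : W}
    (h : Q v w ≠ 0) : trace K V (sqAction D Q v * symAction D Q v w) = 0 := by
  have htr := trace_bracket_mul (sqAction D Q v) (sqAction D Q v) (sqAction D Q w)
  rw [sub_self, zero_mul, map_zero, hD.sqAction_bracket hQ, mul_smul_comm, map_smul] at htr
  exact (smul_eq_zero.mp htr.symm).resolve_left h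

lemma trace_sqAction_mul_symAction_eq_zero (hD : IsRankOneAction D) (hQ : Q.IsAlt) {v u : W}
    (h : Q v u = 0) (w : W) : trace K V (sqAction D Q v * symAction D Q u w) = 0 := by
  by_cases hvw : Q v w = 0
  · rw [← add_sub_cancel_left (sqAction D Q u + sqAction D Q w) (symAction D Q u w),
      ← sqAction_add, mul_sub, mul_add, map_sub, map_add]
    have huw : Q v (u + w) = 0 := by rw [map_add, h, hvw, add_zero]
    simp [hD.trace_sqAction_mul_eq_zero hQ, h, hvw, huw]
  · have hcomm : sqAction D Q v * symAction D Q u v - symAction D Q u v * sqAction D Q v = 0 := by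
      rw [← neg_sub, hD.symAction_bracket_sqAction hQ, ← LinearMap.IsAlt.neg hQ v u, hQ, h]
      simp
    have htr := trace_bracket_mul (sqAction D Q v) (symAction D Q u v) (sqAction D Q w)
    rw [hcomm, hD.symAction_bracket_sqAction hQ, zero_mul, map_zero, mul_add, mul_smul_comm,
      mul_smul_comm, map_add, map_smul, map_smul,
      hD.trace_sqAction_mul_symAction_self hQ hvw, smul_zero, add_zero] at htr
    exact (smul_eq_zero.mp htr.symm).resolve_left hvw

lemma trace_sqAction_mul_proportional (hD : IsRankOneAction D) (hQ : Q.IsAlt) (v w y : W) :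
    trace K V (sqAction D Q v * sqAction D Q w) * Q v y ^ 2 =
      trace K V (sqAction D Q v * sqAction D Q y) * Q v w ^ 2 := by
  set u := Q v y • w - Q v w • y with hu
  have hvu : Q v u = 0 := by
    rw [hu, map_sub, map_smul, map_smul, smul_eq_mul, smul_eq_mul, mul_comm, sub_self]
  have hsum : Q v y ^ 2 • sqAction D Q w = sqAction D Q u + Q v w ^ 2 • sqAction D Q y +
      Q v w • symAction D Q u y := by
    rw [← sqAction_smul, ← sqAction_smul, ← map_smul, ← sqAction_add, hu, sub_add_cancel]
  have htr := congrArg (fun T => trace K V (sqAction D Q v * T)) hsum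
  simp only [mul_add, mul_smul_comm, map_add, map_smul, smul_eq_mul,
    hD.trace_sqAction_mul_eq_zero hQ hvu, hD.trace_sqAction_mul_symAction_eq_zero hQ hvu] at htr
  linear_combination htr

lemma exists_trace_sqAction_mul (hD : IsRankOneAction D) (hQ : Q.IsAlt) :
    ∃ κ : K, ∀ v w, trace K V (sqAction D Q v * sqAction D Q w) = κ * Q v w ^ 2 := by
  by_cases hzero : ∀ v w, Q v w = 0
  · exact ⟨0, fun v w => by rw [hD.trace_sqAction_mul_eq_zero hQ (hzero v w), zero_mul]⟩
  push Not at hzero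
  obtain ⟨v₀, w₀, h₀⟩ := hzero
  refine ⟨trace K V (sqAction D Q v₀ * sqAction D Q w₀) / Q v₀ w₀ ^ 2, fun v w => ?_⟩
  by_cases hvw : Q v w = 0
  · rw [hD.trace_sqAction_mul_eq_zero hQ hvw, hvw, zero_pow two_ne_zero, mul_zero]
  obtain ⟨u, hvu, hv₀u⟩ : ∃ u, Q v u ≠ 0 ∧ Q v₀ u ≠ 0 := by
    by_cases hvw₀ : Q v w₀ = 0
    · by_cases hv₀w : Q v₀ w = 0
      · exact ⟨w + w₀, by simpa [hvw₀], by simpa [hv₀w]⟩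
      · exact ⟨w, hvw, hv₀w⟩
    · exact ⟨w₀, hvw₀, h₀⟩
  have h1 := hD.trace_sqAction_mul_proportional hQ v w u
  have h2 := hD.trace_sqAction_mul_proportional hQ u v v₀
  have h3 := hD.trace_sqAction_mul_proportional hQ v₀ u w₀
  rw [← LinearMap.IsAlt.neg hQ v u, ← LinearMap.IsAlt.neg hQ v₀ u, LinearMap.trace_mul_comm,
    LinearMap.trace_mul_comm K _ (sqAction D Q v₀)] at h2
  have hne : Q v u ^ 2 * Q v₀ u ^ 2 ≠ 0 :=
    mul_ne_zero (pow_ne_zero 2 hvu) (pow_ne_zero 2 hv₀u)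
  rw [div_mul_eq_mul_div, eq_div_iff (pow_ne_zero 2 h₀)]
  refine mul_right_cancel₀ hne ?_
  linear_combination Q v₀ w₀ ^ 2 * Q v₀ u ^ 2 * h1 + Q v₀ w₀ ^ 2 * Q v w ^ 2 * h2 +
    Q v u ^ 2 * Q v w ^ 2 * h3

/- If `Q(v, w) = 1`, then `X = sqAction v` and `Y = sqAction w` satisfy `X Y X = - X`, so that
`- X Y` is an idempotent of trace zero. -/
lemma sqAction_eq_zero_of_trace [CharZero K] [FiniteDimensional K V] (hD : IsRankOneAction D)
    (hQ : Q.IsAlt) (htr : ∀ v w, trace K V (sqAction D Q v * sqAction D Q w) = 0) (v : W) :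
    sqAction D Q v = 0 := by
  by_cases hv : Q v = 0
  · rw [sqAction, hv, map_zero]
  obtain ⟨w, hvw⟩ : ∃ w, Q v w = 1 := by
    obtain ⟨w, hw⟩ := DFunLike.ne_iff.mp hv
    exact ⟨(Q v w)⁻¹ • w, by rw [map_smul, smul_eq_mul, inv_mul_cancel₀ hw]⟩
  set X := sqAction D Q v with hX
  set Y := sqAction D Q w
  have hXYX : X * Y * X = -X := by
    have hXX : X * X = 0 := hD.sq_eq_zero v (Q v) (hQ v)
    have h1 : X * Y - Y * X = symAction D Q v w := by rw [hD.sqAction_bracket hQ, hvw, one_smul]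
    have h2 := hD.symAction_bracket_sqAction hQ v w v
    rw [← h1, ← LinearMap.IsAlt.neg hQ v w, hvw, hQ, symAction_self, ← hX, zero_smul, add_zero,
      neg_one_smul, sub_mul, mul_sub, mul_assoc Y, hXX, ← mul_assoc X X, hXX, mul_zero, zero_mul,
      sub_zero, zero_sub, sub_neg_eq_add, ← mul_assoc, ← two_smul K, ← smul_neg] at h2
    exact smul_right_injective _ (two_ne_zero' K) h2
  have hidem : IsIdempotentElem (-(X * Y)) := by
    rw [IsIdempotentElem, neg_mul_neg, ← mul_assoc, hXYX, neg_mul]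
  have hXY : X * Y = 0 := neg_eq_zero.mp <|
    (LinearMap.IsIdempotentElem.trace_eq_zero_iff hidem).mp (by rw [map_neg, htr, neg_zero])
  rw [hXY, zero_mul] at hXYX
  exact neg_eq_zero.mp hXYX.symm

end IsRankOneAction

end SymplecticAction

section SymplecticBasis

variable {K W : Type*} [Field K] [AddCommGroup W] [Module K W] {m N : ℕ}

/-- The sign `Q (b x) (b x.rev)` in a symplectic basis `b`: it is `1` on the first half of the
indices and `-1` on the second half. -/
def basisSign (K : Type*) [Field K] (x : Fin N) : K := if x < x.rev then 1 else -1

lemma rev_ne (x : Fin (2 * m)) : x.rev ≠ x := by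
  rw [Ne, Fin.ext_iff, Fin.val_rev]
  lia

@[simp] lemma basisSign_rev (x : Fin (2 * m)) : basisSign K x.rev = -basisSign K x := by
  rcases lt_or_gt_of_ne (rev_ne x) with h | h <;> simp [basisSign, h, h.not_gt]

@[simp] lemma basisSign_mul_self (x : Fin (2 * m)) : basisSign K x * basisSign K x = 1 := by
  unfold basisSign
  split_ifs <;> simp

lemma basisSign_ne_zero (x : Fin (2 * m)) : basisSign K x ≠ 0 :=
  left_ne_zero_of_mul_eq_one (basisSign_mul_self x)

/-- A family with the relations of a symplectic basis. The partner of the index `x` is `x.rev`, so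
the basis is ordered as `e₁, …, eₘ, fₘ, …, f₁`. -/
def IsSymplecticFamily (Q : LinearMap.BilinForm K W) (b : Fin N → W) : Prop :=
  ∀ x y, Q (b x) (b y) = if y = x.rev then basisSign K x else 0

variable {Q : LinearMap.BilinForm K W} {b : Fin (2 * m) → W}

namespace IsSymplecticFamily

lemma apply_sum (hb : IsSymplecticFamily Q b) (c : Fin (2 * m) → K) (y : Fin (2 * m)) :
    Q (b y) (∑ x, c x • b x) = basisSign K y * c y.rev := by
  simp [hb y, mul_comm]

lemma linearIndependent (hb : IsSymplecticFamily Q b) : LinearIndependent K b := by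
  refine Fintype.linearIndependent_iff.mpr fun c hc x => ?_
  have h := hb.apply_sum c x.rev
  rw [hc, map_zero, Fin.rev_rev] at h
  exact (mul_eq_zero.mp h.symm).resolve_left (basisSign_ne_zero _)

lemma exists_mem_span_orthogonal_sub (hb : IsSymplecticFamily Q b) (w : W) :
    ∃ u ∈ Submodule.span K (Set.range b), ∀ y, Q (b y) (w - u) = 0 := by
  refine ⟨∑ x, (basisSign K x.rev * Q (b x.rev) w) • b x, Submodule.sum_mem _ fun x _ =>
    Submodule.smul_mem _ _ (Submodule.subset_span ⟨x, rfl⟩), fun y => ?_⟩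
  rw [map_sub, hb.apply_sum, Fin.rev_rev, ← mul_assoc, basisSign_mul_self, one_mul, sub_self]

lemma exists_hyperbolic_pair_orthogonal (hb : IsSymplecticFamily Q b) (hQ : Q.Nondegenerate)
    (hQalt : Q.IsAlt) (hspan : Submodule.span K (Set.range b) ≠ ⊤) :
    ∃ e f, Q e f = 1 ∧ ∀ x, Q (b x) e = 0 ∧ Q (b x) f = 0 := by
  obtain ⟨w, -, hw⟩ := SetLike.exists_of_lt hspan.lt_top
  obtain ⟨u, hu, hwu⟩ := hb.exists_mem_span_orthogonal_sub w
  have hne : w - u ≠ 0 := fun h => hw (sub_eq_zero.mp h ▸ hu)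
  obtain ⟨y, hy⟩ : ∃ y, Q (w - u) y ≠ 0 := by
    by_contra! h
    exact hne (hQ.1 _ h)
  obtain ⟨t, ht, hyt⟩ := hb.exists_mem_span_orthogonal_sub y
  have hwt : Q (w - u) t = 0 := by
    suffices h : Submodule.span K (Set.range b) ≤ LinearMap.ker (Q (w - u)) from h ht
    refine Submodule.span_le.mpr ?_
    rintro _ ⟨x, rfl⟩
    rw [SetLike.mem_coe, LinearMap.mem_ker, ← hQalt.neg_eq, hwu, neg_zero]
  refine ⟨w - u, (Q (w - u) y)⁻¹ • (y - t), ?_, fun x => ⟨hwu x, ?_⟩⟩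
  · rw [map_smul, map_sub (Q _) y t, hwt, sub_zero, smul_eq_mul, inv_mul_cancel₀ hy]
  · rw [map_smul, hyt, smul_zero]

lemma cons_snoc {b : Fin N → W} (hb : IsSymplecticFamily Q b) (hQ : Q.IsAlt) {e f : W}
    (hef : Q e f = 1) (horth : ∀ x, Q (b x) e = 0 ∧ Q (b x) f = 0) :
    IsSymplecticFamily Q (Fin.cons e (Fin.snoc b f : Fin (N + 1) → W) : Fin (N + 2) → W) := by
  have hbe : ∀ x, Q e (b x) = 0 := fun x => by rw [← hQ.neg_eq, (horth x).1, neg_zero]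
  have hbf : ∀ x, Q f (b x) = 0 := fun x => by rw [← hQ.neg_eq, (horth x).2, neg_zero]
  have hfe : Q f e = -1 := by rw [← hQ.neg_eq, hef]
  have hrev : ∀ x : Fin N, x.castSucc.succ.rev = x.rev.castSucc.succ := fun x => by
    rw [Fin.rev_succ, Fin.rev_castSucc, Fin.succ_castSucc]
  have hlast : ∀ x : Fin N, Fin.last (N + 1) ≠ x.castSucc.succ := fun x => by
    rw [Fin.succ_castSucc]
    exact (Fin.castSucc_ne_last _).symm
  intro x y
  refine Fin.cases ?_ (Fin.lastCases ?_ fun x => ?_) x <;>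
    refine Fin.cases ?_ (Fin.lastCases ?_ fun y => ?_) y <;>
    simp [hef, hfe, hbe, hbf, horth, hQ.self_eq_zero, basisSign, hb _ _, hrev, hlast,
      (Fin.succ_ne_zero _).symm]

end IsSymplecticFamily

lemma exists_symplecticBasis [FiniteDimensional K W] (hQ : Q.Nondegenerate) (hQalt : Q.IsAlt) :
    ∃ (m : ℕ) (b : Basis (Fin (2 * m)) K W), IsSymplecticFamily Q b := by
  classical
  let p : ℕ → Prop := fun m => ∃ b : Fin (2 * m) → W, IsSymplecticFamily Q b
  have hbound : ∀ m, p m → m ≤ Module.finrank K W := by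
    rintro m ⟨b, hb⟩
    have := hb.linearIndependent.fintype_card_le_finrank
    rw [Fintype.card_fin] at this
    lia
  obtain ⟨b, hb⟩ : p (Nat.findGreatest p (Module.finrank K W)) :=
    Nat.findGreatest_spec (Nat.zero_le _) ⟨fun _ => 0, fun x => x.elim0⟩
  have hspan : Submodule.span K (Set.range b) = ⊤ := by
    by_contra h
    obtain ⟨e, f, hef, horth⟩ := hb.exists_hyperbolic_pair_orthogonal hQ hQalt h
    have hp : p (_ + 1) := ⟨_, hb.cons_snoc hQalt hef horth⟩
    exact (Nat.lt_succ_self _).not_ge (Nat.le_findGreatest (hbound _ hp) hp)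
  refine ⟨_, Basis.mk hb.linearIndependent hspan.ge, ?_⟩
  rw [Basis.coe_mk]
  exact hb

end SymplecticBasis

section RootVectors

variable {K W V : Type*} [Field K] [AddCommGroup W] [Module K W] [AddCommGroup V] [Module K V]
  {m : ℕ}

/-- The action of the matrix unit with entry `1` in row `x` and column `t`. -/
noncomputable def unitAction (D : W →ₗ[K] Dual K W →ₗ[K] End K V) (b : Basis (Fin (2 * m)) K W)
    (x t : Fin (2 * m)) : End K V :=
  D (b x) (b.coord t)

/-- The action of the standard root vectors of the symplectic Lie algebra in a symplectic basis;
for `x = t` it is the action of the standard elements of the Cartan subalgebra. The vector lowers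
the sum of the indices of a monomial in the basis if `x < t` and raises it if `t < x`. -/
noncomputable def rootAction (D : W →ₗ[K] Dual K W →ₗ[K] End K V) (b : Basis (Fin (2 * m)) K W)
    (x t : Fin (2 * m)) : End K V :=
  unitAction D b x t - (basisSign K x * basisSign K t) • unitAction D b t.rev x.rev

variable {D : W →ₗ[K] Dual K W →ₗ[K] End K V} {b : Basis (Fin (2 * m)) K W}
  {Q : LinearMap.BilinForm K W}

lemma sum_repr_smul_symAction (v : W) :
    ∑ x, ∑ t : Fin (2 * m), (b.repr v x * b.repr v t.rev) • symAction D Q (b x) (b t.rev) =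
      symAction D Q v v := by
  have hrev : ∀ x, ∑ t : Fin (2 * m),
      (b.repr v x * b.repr v t.rev) • symAction D Q (b x) (b t.rev) =
        b.repr v x • symAction D Q (b x) v := fun x => by
    rw [← Equiv.sum_comp Fin.revPerm]
    simp only [Fin.revPerm_apply, Fin.rev_rev, mul_smul, ← Finset.smul_sum, ← map_smul, ← map_sum,
      b.sum_repr]
  rw [Finset.sum_congr rfl fun x _ => hrev x]
  conv_rhs => rw [← b.sum_repr v, LinearMap.map_sum₂, b.sum_repr]
  simp only [map_smul, LinearMap.smul_apply]

namespace IsSymplecticFamily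

lemma apply_eq_coord (hb : IsSymplecticFamily Q b) (x : Fin (2 * m)) :
    Q (b x) = basisSign K x • b.coord x.rev :=
  b.ext fun y => by simp [hb x y, Finsupp.single_apply]

lemma apply_basis_right (hb : IsSymplecticFamily Q b) (hQ : Q.IsAlt) (v : W) (x : Fin (2 * m)) :
    Q v (b x) = -(basisSign K x * b.repr v x.rev) := by
  rw [← hQ.neg_eq, hb.apply_eq_coord, LinearMap.smul_apply, Basis.coord_apply, smul_eq_mul]

lemma rootAction_eq (hb : IsSymplecticFamily Q b) (x t : Fin (2 * m)) :
    rootAction D b x t = -basisSign K t • symAction D Q (b x) (b t.rev) := by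
  rw [symAction_apply, hb.apply_eq_coord, hb.apply_eq_coord, Fin.rev_rev, basisSign_rev, map_smul,
    map_smul, smul_add, smul_smul, smul_smul, neg_mul_neg, basisSign_mul_self, one_smul, neg_mul,
    neg_smul, ← sub_eq_add_neg, mul_comm (basisSign K t)]
  rfl

lemma rootAction_mem (hb : IsSymplecticFamily Q b) (x t : Fin (2 * m)) :
    rootAction D b x t ∈ symplecticAlgebra D Q := by
  rw [hb.rootAction_eq]
  exact Submodule.smul_mem _ _ (symAction_mem _ _)

lemma trace_sqAction_mul_rootAction_smul (hb : IsSymplecticFamily Q b) (hQ : Q.IsAlt) {κ : K}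
    (hκ : ∀ v w, trace K V (sqAction D Q v * sqAction D Q w) = κ * Q v w ^ 2) (v : W)
    (x t : Fin (2 * m)) :
    trace K V (sqAction D Q v * rootAction D b t x) • rootAction D b x t =
      (-2 * κ) • (b.repr v x * b.repr v t.rev) • symAction D Q (b x) (b t.rev) := by
  have hsym : ∀ a c, trace K V (sqAction D Q v * symAction D Q a c) = 2 * κ * (Q v a * Q v c) :=
    fun a c => by
      rw [← add_sub_cancel_left (sqAction D Q a + sqAction D Q c) (symAction D Q a c),
        ← sqAction_add, mul_sub, mul_add, map_sub, map_add, hκ, hκ, hκ, map_add]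
      ring
  have hx := basisSign_mul_self (K := K) x
  have ht := basisSign_mul_self (K := K) t
  rw [hb.rootAction_eq, hb.rootAction_eq, mul_smul_comm, map_smul, hsym,
    hb.apply_basis_right hQ, hb.apply_basis_right hQ, basisSign_rev, Fin.rev_rev, smul_smul,
    smul_smul, smul_eq_mul]
  congr 1
  linear_combination (2 * κ * b.repr v x * b.repr v t.rev) *
    (-(basisSign K t * basisSign K t) * hx - ht)

lemma sum_trace_smul_rootAction (hb : IsSymplecticFamily Q b) (hQ : Q.IsAlt) {κ : K}
    (hκ : ∀ v w, trace K V (sqAction D Q v * sqAction D Q w) = κ * Q v w ^ 2) {T : End K V}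
    (hT : T ∈ symplecticAlgebra D Q) :
    ∑ x, ∑ t, trace K V (T * rootAction D b t x) • rootAction D b x t = (-4 * κ) • T := by
  let F : End K V →ₗ[K] End K V := ∑ x, ∑ t,
    (trace K V ∘ₗ LinearMap.mulRight K (rootAction D b t x)).smulRight (rootAction D b x t)
  suffices h : symplecticAlgebra D Q ≤ LinearMap.eqLocus F ((-4 * κ) • LinearMap.id) by
    simpa [F] using h hT
  refine Submodule.span_le.mpr ?_
  rintro _ ⟨v, rfl⟩
  simp only [F, SetLike.mem_coe, LinearMap.mem_eqLocus, LinearMap.sum_apply,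
    LinearMap.smulRight_apply, LinearMap.comp_apply, LinearMap.mulRight_apply,
    hb.trace_sqAction_mul_rootAction_smul hQ hκ, ← Finset.smul_sum]
  rw [sum_repr_smul_symAction, symAction_self, smul_smul, LinearMap.smul_apply, LinearMap.id_apply]
  congr 1
  ring

lemma exists_isTraceDual_rootAction [CharZero K] [FiniteDimensional K V]
    (hb : IsSymplecticFamily Q b) (hD : IsRankOneAction D) (hQ : Q.IsAlt) :
    ∃ c : K, c ≠ 0 ∧ IsTraceDual (symplecticAlgebra D Q)
      (fun p : Fin (2 * m) × Fin (2 * m) => rootAction D b p.1 p.2)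
      (fun p => c • rootAction D b p.2 p.1) := by
  obtain ⟨κ, hκ⟩ := hD.exists_trace_sqAction_mul hQ
  obtain ⟨c, hc, hcκ⟩ : ∃ c : K, c ≠ 0 ∧ ∀ T ∈ symplecticAlgebra D Q, c • (-4 * κ) • T = T := by
    by_cases h0 : κ = 0
    · have hbot : symplecticAlgebra D Q = ⊥ := by
        rw [symplecticAlgebra, Submodule.span_eq_bot]
        rintro _ ⟨v, rfl⟩
        exact hD.sqAction_eq_zero_of_trace hQ (fun v w => by rw [hκ, h0, zero_mul]) v
      refine ⟨1, one_ne_zero, fun T hT => ?_⟩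
      rw [hbot, Submodule.mem_bot] at hT
      rw [hT, smul_zero, smul_zero]
    · have h4 : -4 * κ ≠ 0 := mul_ne_zero (by norm_num) h0
      exact ⟨(-4 * κ)⁻¹, inv_ne_zero h4, fun T _ => by rw [smul_smul, inv_mul_cancel₀ h4, one_smul]⟩
  refine ⟨c, hc, fun p => hb.rootAction_mem _ _,
    fun p => Submodule.smul_mem _ _ (hb.rootAction_mem _ _), fun T hT => ?_, fun T hT => ?_⟩
  · rw [Fintype.sum_prod_type]
    simp only [mul_smul_comm, map_smul, smul_assoc, ← Finset.smul_sum]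
    rw [hb.sum_trace_smul_rootAction hQ hκ hT, hcκ T hT]
  · rw [Fintype.sum_prod_type_right]
    simp only [smul_comm _ c, ← Finset.smul_sum]
    rw [hb.sum_trace_smul_rootAction hQ hκ hT, hcκ T hT]

end IsSymplecticFamily

section Brackets

lemma unitAction_bracket (hD : IsRankOneAction D) (x t y s : Fin (2 * m)) :
    unitAction D b x t * unitAction D b y s - unitAction D b y s * unitAction D b x t =
      (if y = t then unitAction D b x s else 0) - if x = s then unitAction D b y t else 0 := by
  simp only [unitAction, hD.commutator, Basis.coord_apply, Basis.repr_self, Finsupp.single_apply,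
    ite_smul, one_smul, zero_smul]

lemma rootAction_self (x : Fin (2 * m)) :
    rootAction D b x x = unitAction D b x x - unitAction D b x.rev x.rev := by
  rw [rootAction, basisSign_mul_self, one_smul]

lemma sum_smul_unitAction_bracket (hD : IsRankOneAction D) (c : Fin (2 * m) → K)
    (x t : Fin (2 * m)) :
    (∑ y, c y • unitAction D b y y) * unitAction D b x t -
      unitAction D b x t * ∑ y, c y • unitAction D b y y = (c x - c t) • unitAction D b x t := by
  rw [Finset.sum_mul, Finset.mul_sum, ← Finset.sum_sub_distrib]
  simp only [smul_mul_assoc, mul_smul_comm, ← smul_sub, unitAction_bracket hD]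
  simp only [smul_sub, smul_ite, smul_zero, Finset.sum_sub_distrib, Finset.sum_ite_eq,
    Finset.sum_ite_eq', Finset.mem_univ, if_true, sub_smul]

/-- The Cartan element for which `rootAction D b x t` has weight `2 (x - t)`. -/
noncomputable def gradingAction (D : W →ₗ[K] Dual K W →ₗ[K] End K V)
    (b : Basis (Fin (2 * m)) K W) : End K V :=
  ∑ y : Fin (2 * m), ((y : K) - (y.rev : K)) • unitAction D b y y

lemma gradingAction_eq : gradingAction D b = ∑ y : Fin (2 * m), (y : K) • rootAction D b y y := by
  simp only [gradingAction, rootAction_self, sub_smul, smul_sub, Finset.sum_sub_distrib]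
  congr 1
  rw [← Equiv.sum_comp Fin.revPerm]
  simp only [Fin.revPerm_apply, Fin.rev_rev]

lemma gradingAction_bracket (hD : IsRankOneAction D) (x t : Fin (2 * m)) :
    gradingAction D b * rootAction D b x t - rootAction D b x t * gradingAction D b =
      (2 * ((x : K) - (t : K))) • rootAction D b x t := by
  have hrev : ∀ y : Fin (2 * m), (y.rev : K) = 2 * m - 1 - y := fun y => by
    have h : ((y.rev + y + 1 : ℕ) : K) = (2 * m : ℕ) := by
      congr 1
      rw [Fin.val_rev]
      omega
    push_cast at h
    linear_combination h
  rw [rootAction, mul_sub, sub_mul, mul_smul_comm, smul_mul_assoc, sub_sub_sub_comm, ← smul_sub,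
    gradingAction, sum_smul_unitAction_bracket hD, sum_smul_unitAction_bracket hD, Fin.rev_rev,
    Fin.rev_rev, hrev, hrev]
  module

lemma rootAction_bracket_swap (hD : IsRankOneAction D) {x t : Fin (2 * m)} (h : x ≠ t) :
    rootAction D b x t * rootAction D b t x - rootAction D b t x * rootAction D b x t =
      (1 + if t = x.rev then 1 else 0 : K) • (rootAction D b x x - rootAction D b t t) := by
  have hE := unitAction_bracket (b := b) hD x t t x
  have hx := basisSign_mul_self (K := K) x
  have ht := basisSign_mul_self (K := K) t
  by_cases htx : t = x.rev
  · subst htx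
    simp only [rootAction, Fin.rev_rev, basisSign_rev, mul_neg, neg_mul, hx, if_true] at hE ⊢
    simp only [neg_neg, neg_smul, one_smul, sub_neg_eq_add, add_mul, mul_add]
    linear_combination (norm := module) (4 : K) • hE
  · have hE' := unitAction_bracket (b := b) hD t.rev x.rev x.rev t.rev
    have h1 := unitAction_bracket (b := b) hD x t x.rev t.rev
    have h2 := unitAction_bracket (b := b) hD t.rev x.rev t x
    have htx' : x ≠ t.rev := fun e => htx (by rw [e, Fin.rev_rev])
    simp only [htx, htx', Ne.symm htx, Ne.symm htx', if_false, if_true] at hE hE' h1 h2 ⊢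
    have hσ : (basisSign K x * basisSign K t) * (basisSign K x * basisSign K t) = 1 := by
      linear_combination basisSign K t * basisSign K t * hx + ht
    rw [rootAction_self, rootAction_self]
    simp only [rootAction, mul_comm (basisSign K t), mul_sub, sub_mul,
      mul_smul_comm, smul_mul_assoc, smul_sub, smul_smul, hσ]
    linear_combination (norm := module) hE + hE' -
      (basisSign K x * basisSign K t) • (h1 + h2)

end Brackets

section Casimir

/-- A vector of `V` killed by all raising root vectors. -/
def IsPrimitive (D : W →ₗ[K] Dual K W →ₗ[K] End K V) (b : Basis (Fin (2 * m)) K W) (z : V) :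
    Prop :=
  ∀ ⦃x t⦄, t < x → rootAction D b x t z = 0

lemma sum_sum_lt_sub (w : Fin (2 * m) → V) :
    ∑ x, ∑ t, (if t < x then w x - w t else 0) =
      ∑ x : Fin (2 * m), ((x : K) - (x.rev : K)) • w x := by
  have hsplit : ∀ x t, (if t < x then w x - w t else 0) =
      (if t < x then w x else 0) - if t < x then w t else 0 := fun x t => by split_ifs <;> simp
  simp only [hsplit, Finset.sum_sub_distrib]
  rw [Finset.sum_comm (f := fun x t => if t < x then w t else 0), ← Finset.sum_sub_distrib]
  refine Finset.sum_congr rfl fun x _ => ?_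
  have hgt : (Finset.univ.filter fun t => x < t).card = (x.rev : ℕ) := by
    rw [Finset.filter_lt_eq_Ioi, Fin.card_Ioi, Fin.val_rev, Nat.sub_sub, add_comm]
  have hlt : (Finset.univ.filter fun t => t < x).card = (x : ℕ) := by
    rw [Finset.filter_gt_eq_Iio, Fin.card_Iio]
  rw [← Finset.sum_filter, ← Finset.sum_filter, Finset.sum_const, Finset.sum_const, hgt, hlt,
    sub_smul, Nat.cast_smul_eq_nsmul, Nat.cast_smul_eq_nsmul]

lemma sum_rev_lt_sub (w : Fin (2 * m) → V) :
    ∑ x, (if x.rev < x then w x - w x.rev else 0) = -∑ x, basisSign K x • w x := by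
  have hsplit : ∀ x : Fin (2 * m), (if x.rev < x then w x - w x.rev else 0) =
      (if x.rev < x then w x else 0) - if x.rev < x then w x.rev else 0 := fun x => by
    split_ifs <;> simp
  simp only [hsplit, Finset.sum_sub_distrib]
  rw [← Equiv.sum_comp Fin.revPerm fun x : Fin (2 * m) => if x.rev < x then w x.rev else 0,
    ← Finset.sum_sub_distrib, ← Finset.sum_neg_distrib]
  refine Finset.sum_congr rfl fun x _ => ?_
  rcases lt_or_gt_of_ne (rev_ne x) with h | h
  · simp [basisSign, h, h.not_gt]
  · simp [basisSign, h, h.not_gt]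

lemma IsPrimitive.rootAction_rootAction {z : V} (hz : IsPrimitive D b z) (hD : IsRankOneAction D)
    (x t : Fin (2 * m)) :
    rootAction D b x t (rootAction D b t x z) =
      (if x = t then rootAction D b x x (rootAction D b x x z) else 0) +
        ((if t < x then rootAction D b x x z - rootAction D b t t z else 0) +
          if t = x.rev then
            (if x.rev < x then rootAction D b x x z - rootAction D b x.rev x.rev z else 0) else 0)
    := by
  rcases lt_trichotomy x t with h | rfl | h
  · have ht : ¬ (t = x.rev ∧ x.rev < x) := fun e => (e.1 ▸ h).not_gt e.2
    rw [hz h, map_zero, if_neg h.ne, if_neg h.not_gt, ← ite_and, if_neg ht, add_zero, add_zero]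
  · rw [if_pos rfl, if_neg (lt_irrefl x), if_neg (rev_ne x).symm, add_zero, add_zero]
  · have hbr := LinearMap.congr_fun (rootAction_bracket_swap (b := b) hD h.ne') z
    rw [LinearMap.sub_apply, Module.End.mul_apply, Module.End.mul_apply, hz h, map_zero,
      sub_zero] at hbr
    rw [hbr, if_neg h.ne', if_pos h, zero_add, LinearMap.smul_apply, add_smul, one_smul]
    by_cases ht : t = x.rev
    · subst ht
      simp [h]
    · simp [ht]

lemma IsPrimitive.sum_rootAction_rootAction {z : V} (hz : IsPrimitive D b z)
    (hD : IsRankOneAction D) :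
    ∑ p : Fin (2 * m) × Fin (2 * m), rootAction D b p.1 p.2 (rootAction D b p.2 p.1 z) =
      ∑ x : Fin (2 * m), (rootAction D b x x (rootAction D b x x z) +
        ((x : K) - (x.rev : K) - basisSign K x) • rootAction D b x x z) := by
  rw [Fintype.sum_prod_type, Finset.sum_congr rfl fun x _ => Finset.sum_congr rfl fun t _ =>
    hz.rootAction_rootAction hD x t]
  simp only [Finset.sum_add_distrib, Finset.sum_ite_eq, Finset.sum_ite_eq', Finset.mem_univ,
    if_true]
  rw [sum_sum_lt_sub (K := K) fun x => rootAction D b x x z,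
    sum_rev_lt_sub (K := K) fun x => rootAction D b x x z]
  rw [← sub_eq_add_neg, ← Finset.sum_sub_distrib]
  simp only [← sub_smul]

lemma IsSymplecticFamily.exists_isPrimitive_mem [IsAlgClosed K] [CharZero K]
    [FiniteDimensional K V] (hb : IsSymplecticFamily Q b) (hD : IsRankOneAction D)
    {U : Submodule K V} (hU : IsInvariant (symplecticAlgebra D Q) U) (h : U ≠ ⊥) :
    ∃ z ∈ U, z ≠ 0 ∧ IsPrimitive D b z := by
  have hgrading : gradingAction D b ∈ symplecticAlgebra D Q := by
    rw [gradingAction_eq]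
    exact sum_mem fun y _ => Submodule.smul_mem _ _ (hb.rootAction_mem y y)
  obtain ⟨z, hzU, hz, hraise⟩ := exists_eigenvector_mem_forall_raising_eq_zero (hU _ hgrading) h
  refine ⟨z, hzU, hz, fun x t htx => hraise _ (hU _ (hb.rootAction_mem x t))
    (2 * ((x : ℕ) - (t : ℕ))) (by have := Fin.lt_def.mp htx; omega) ?_⟩
  rw [gradingAction_bracket hD, Nat.cast_mul, Nat.cast_sub (Fin.lt_def.mp htx).le, Nat.cast_ofNat]

end Casimir

end RootVectors

section ExteriorAction

variable {R W : Type*} [CommRing R] [AddCommGroup W] [Module R W]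

/-- Exterior multiplication by a vector. -/
def create : W →ₗ[R] End R (ExteriorAlgebra R W) :=
  LinearMap.mul R (ExteriorAlgebra R W) ∘ₗ ExteriorAlgebra.ι R

/-- Contraction with a linear form. -/
def annihilate : Dual R W →ₗ[R] End R (ExteriorAlgebra R W) :=
  CliffordAlgebra.contractLeft

/-- The action on the exterior algebra of the rank one endomorphisms `φ(·) v` as derivations. -/
def exteriorAction : W →ₗ[R] Dual R W →ₗ[R] End R (ExteriorAlgebra R W) :=
  (LinearMap.mul R _).compl₁₂ create annihilate

lemma create_apply (v : W) (z : ExteriorAlgebra R W) : create v z = ExteriorAlgebra.ι R v * z := rfl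

lemma exteriorAction_apply (v : W) (φ : Dual R W) (z : ExteriorAlgebra R W) :
    exteriorAction v φ z = create v (annihilate φ z) := rfl

lemma annihilate_create (φ : Dual R W) (v : W) (z : ExteriorAlgebra R W) :
    annihilate φ (create v z) = φ v • z - create v (annihilate φ z) :=
  CliffordAlgebra.contractLeft_ι_mul φ v z

lemma annihilate_algebraMap (φ : Dual R W) (r : R) :
    annihilate φ (algebraMap R (ExteriorAlgebra R W) r) = 0 :=
  CliffordAlgebra.contractLeft_algebraMap _ φ r

lemma annihilate_anticomm (φ ψ : Dual R W) (z : ExteriorAlgebra R W) :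
    annihilate φ (annihilate ψ z) = -annihilate ψ (annihilate φ z) :=
  CliffordAlgebra.contractLeft_comm φ ψ z

lemma create_anticomm (v w : W) (z : ExteriorAlgebra R W) :
    create v (create w z) = -create w (create v z) := by
  simp only [create_apply, ← mul_assoc,
    eq_neg_of_add_eq_zero_left (ExteriorAlgebra.ι_add_mul_swap (R := R) v w), neg_mul]

lemma create_create_self (v : W) (z : ExteriorAlgebra R W) : create v (create v z) = 0 := by
  rw [create_apply, create_apply, ← mul_assoc, ExteriorAlgebra.ι_sq_zero, zero_mul]

lemma create_induction {p : ExteriorAlgebra R W → Prop}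
    (algebraMap : ∀ r, p (algebraMap R _ r)) (add : ∀ x y, p x → p y → p (x + y))
    (create : ∀ x v, p x → p (create v x)) (z : ExteriorAlgebra R W) : p z :=
  CliffordAlgebra.left_induction (Q := (0 : QuadraticForm R W)) algebraMap add create z

lemma exteriorAction_algebraMap (v : W) (φ : Dual R W) (r : R) :
    exteriorAction v φ (algebraMap R (ExteriorAlgebra R W) r) = 0 := by
  rw [exteriorAction_apply, annihilate_algebraMap, map_zero]

lemma exteriorAction_create (v : W) (φ : Dual R W) (u : W) (z : ExteriorAlgebra R W) :
    exteriorAction v φ (create u z) = φ u • create v z + create u (exteriorAction v φ z) := by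
  rw [exteriorAction_apply, annihilate_create, map_sub, map_smul, create_anticomm v u,
    sub_neg_eq_add, exteriorAction_apply]

lemma exteriorAction_commutator (v : W) (φ : Dual R W) (w : W) (ψ : Dual R W) :
    exteriorAction v φ * exteriorAction w ψ - exteriorAction w ψ * exteriorAction v φ =
      φ w • exteriorAction v ψ - ψ v • exteriorAction w φ := by
  refine LinearMap.ext fun z => ?_
  simp only [LinearMap.sub_apply, Module.End.mul_apply, LinearMap.smul_apply, exteriorAction_apply,
    annihilate_create, map_sub, map_smul]
  rw [annihilate_anticomm ψ φ, create_anticomm w v, map_neg, map_neg, neg_neg]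
  abel

lemma exteriorAction_mul_self {v : W} {φ : Dual R W} (h : φ v = 0) :
    exteriorAction v φ * exteriorAction v φ = 0 := by
  refine LinearMap.ext fun z => ?_
  rw [Module.End.mul_apply, exteriorAction_apply, exteriorAction_apply, annihilate_create, h,
    zero_smul, zero_sub, map_neg, create_create_self, neg_zero, LinearMap.zero_apply]

lemma map_create (f : W →ₗ[R] W) (v : W) (z : ExteriorAlgebra R W) :
    ExteriorAlgebra.map f (create v z) = create (f v) (ExteriorAlgebra.map f z) := by
  rw [create_apply, map_mul, ExteriorAlgebra.map_apply_ι, create_apply]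

lemma map_exteriorAction (f : W →ₗ[R] W) (v : W) (φ : Dual R W) (z : ExteriorAlgebra R W) :
    ExteriorAlgebra.map f (exteriorAction v (φ ∘ₗ f) z) =
      exteriorAction (f v) φ (ExteriorAlgebra.map f z) := by
  induction z using create_induction with
  | algebraMap r =>
    rw [exteriorAction_algebraMap, map_zero, AlgHom.commutes, exteriorAction_algebraMap]
  | add x y hx hy => simp only [map_add, hx, hy]
  | create x u hx =>
    rw [exteriorAction_create, map_add, map_smul, map_create, map_create, hx, map_create,
      exteriorAction_create, LinearMap.comp_apply]

lemma map_transvection (v : W) (φ : Dual R W) (z : ExteriorAlgebra R W) :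
    ExteriorAlgebra.map (LinearMap.transvection φ v) z = z + exteriorAction v φ z := by
  induction z using create_induction with
  | algebraMap r => rw [exteriorAction_algebraMap, AlgHom.commutes, add_zero]
  | add x y hx hy => simp only [map_add, hx, hy, add_add_add_comm]
  | create x u hx =>
    rw [map_create, hx, exteriorAction_create, LinearMap.transvection.apply]
    simp only [map_add, map_smul, LinearMap.add_apply, LinearMap.smul_apply, exteriorAction_apply,
      create_create_self, smul_zero, add_zero]
    abel

lemma create_mem_exteriorPower (v : W) {n : ℕ} {z : ExteriorAlgebra R W}
    (hz : z ∈ ⋀[R]^n W) : create v z ∈ ⋀[R]^(n + 1) W := by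
  rw [ExteriorAlgebra.exteriorPower, pow_succ']
  exact Submodule.mul_mem_mul (LinearMap.mem_range_self _ v) hz

lemma exteriorAction_mem_exteriorPower (v : W) (φ : Dual R W) (n : ℕ) :
    ∀ z ∈ ⋀[R]^n W, exteriorAction v φ z ∈ ⋀[R]^n W := by
  induction n with
  | zero =>
    intro z hz
    rw [ExteriorAlgebra.exteriorPower, pow_zero, Submodule.mem_one] at hz
    obtain ⟨r, rfl⟩ := hz
    rw [exteriorAction_algebraMap]
    exact zero_mem _
  | succ n ih =>
    intro z hz
    rw [ExteriorAlgebra.exteriorPower, pow_succ'] at hz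
    induction hz using Submodule.mul_induction_on' with
    | mem_mul_mem m hm z hz =>
      obtain ⟨u, rfl⟩ := hm
      rw [← create_apply, exteriorAction_create]
      exact add_mem (Submodule.smul_mem _ _ (create_mem_exteriorPower v hz))
        (create_mem_exteriorPower u (ih z hz))
    | add x _ y _ hx hy =>
      rw [map_add]
      exact add_mem hx hy

lemma exteriorPower_map_coe {n : ℕ} (f : W →ₗ[R] W) (z : ⋀[R]^n W) :
    (exteriorPower.map n f z : ExteriorAlgebra R W) = ExteriorAlgebra.map f z := by
  suffices h : (⋀[R]^n W).subtype ∘ₗ exteriorPower.map n f =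
      (ExteriorAlgebra.map f).toLinearMap ∘ₗ (⋀[R]^n W).subtype from LinearMap.congr_fun h z
  ext m
  simp

/-- The restriction of `exteriorAction` to an exterior power. -/
def exteriorPowerAction (n : ℕ) : W →ₗ[R] Dual R W →ₗ[R] End R (⋀[R]^n W) :=
  LinearMap.mk₂ R
    (fun v φ => (exteriorAction v φ).restrict (exteriorAction_mem_exteriorPower v φ n))
    (fun v w φ => LinearMap.ext fun z => Subtype.ext <| by simp)
    (fun c v φ => LinearMap.ext fun z => Subtype.ext <| by simp)
    (fun v φ ψ => LinearMap.ext fun z => Subtype.ext <| by simp)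
    (fun c v φ => LinearMap.ext fun z => Subtype.ext <| by simp)

lemma exteriorPowerAction_coe {n : ℕ} (v : W) (φ : Dual R W) (z : ⋀[R]^n W) :
    (exteriorPowerAction n v φ z : ExteriorAlgebra R W) = exteriorAction v φ z := rfl

end ExteriorAction

section MonomialBasis

lemma toDual_comm {R M ι : Type*} [CommRing R] [AddCommGroup M] [Module R M] [DecidableEq ι]
    (b : Basis ι R M) (u v : M) : b.toDual u v = b.toDual v u := by
  suffices h : b.toDual = b.toDual.flip from LinearMap.congr_fun₂ h u v
  exact b.ext fun i => b.ext fun j => by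
    rw [LinearMap.flip_apply, b.toDual_apply, b.toDual_apply]
    exact if_congr eq_comm rfl rfl

variable {R W ι : Type*} [CommRing R] [AddCommGroup W] [Module R W] [LinearOrder ι]
  (b : Basis ι R W)

lemma repr_eq_zero_of_card_ne {n : ℕ} {z : ExteriorAlgebra R W} (hz : z ∈ ⋀[R]^n W)
    {I : Finset ι} (hI : I.card ≠ n) : b.ExteriorAlgebra.repr z I = 0 := by
  have hspan : ⋀[R]^n W ≤ Submodule.span R (b.ExteriorAlgebra '' {I | I.card = n}) := by
    rw [← exteriorPower.ιMulti_family_span_fixedDegree_of_span R b.span_eq]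
    refine Submodule.span_mono ?_
    rintro _ ⟨s, rfl⟩
    exact ⟨s.1, s.2, ExteriorAlgebra.basis_apply_powersetCard b s⟩
  have h := b.ExteriorAlgebra.mem_span_image.mp (hspan hz)
  exact Finsupp.notMem_support_iff.mp fun h0 => hI (h h0)

lemma create_basis {x : ι} {I : Finset ι} (hx : x ∉ I) :
    ∃ ε : ℤˣ, create (b x) (b.ExteriorAlgebra I) = ε • b.ExteriorAlgebra (insert x I) := by
  have hι : ExteriorAlgebra.ι R (b x) = b.ExteriorAlgebra {x} := by
    rw [ExteriorAlgebra.basis_apply_ofCard b (Finset.card_singleton x),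
      ExteriorAlgebra.ιMulti_family, ExteriorAlgebra.ιMulti_apply]
    simp [Set.powersetCard.ofFinEmbEquiv_symm_apply, Set.powersetCard.ofCard]
  let s : Set.powersetCard ι 1 := Set.powersetCard.ofCard (Finset.card_singleton x)
  let t : Set.powersetCard ι I.card := Set.powersetCard.ofCard rfl
  have hst : Disjoint s.val t.val := Finset.disjoint_singleton_left.mpr hx
  have hunion : ((Set.powersetCard.disjUnion hst : Set.powersetCard ι (1 + I.card)) : Finset ι) =
      insert x I := by
    ext y
    simp [s, t, Set.powersetCard.disjUnion, Set.powersetCard.ofCard]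
  refine ⟨(Set.powersetCard.permOfDisjoint hst).sign, ?_⟩
  rw [create_apply, hι, ← hunion]
  exact ExteriorAlgebra.basis_mul_of_disjoint b s t hst

lemma annihilate_basis_of_notMem {x : ι} {I : Finset ι} (hx : x ∉ I) :
    annihilate (b.coord x) (b.ExteriorAlgebra I) = 0 := by
  induction I using Finset.induction_on with
  | empty =>
    rw [ExteriorAlgebra.basis_apply_ofCard b Finset.card_empty, ExteriorAlgebra.ιMulti_family,
      ExteriorAlgebra.ιMulti_zero_apply, ← map_one (algebraMap R _), annihilate_algebraMap]
  | insert y I hy ih =>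
    rw [Finset.mem_insert, not_or] at hx
    obtain ⟨ε, h⟩ := create_basis b hy
    rw [← smul_eq_zero_iff_eq ε, ← LinearMap.map_smul_of_tower, ← h, annihilate_create, ih hx.2,
      map_zero, sub_zero, b.coord_apply, b.repr_self, Finsupp.single_eq_of_ne hx.1, zero_smul]

lemma annihilate_basis_of_mem {x : ι} {I : Finset ι} (hx : x ∈ I) :
    ∃ ε : ℤˣ, annihilate (b.coord x) (b.ExteriorAlgebra I) = ε • b.ExteriorAlgebra (I.erase x) ∧
      create (b x) (b.ExteriorAlgebra (I.erase x)) = ε • b.ExteriorAlgebra I := by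
  obtain ⟨ε, h⟩ := create_basis b (Finset.notMem_erase x I)
  rw [Finset.insert_erase hx] at h
  refine ⟨ε, ?_, h⟩
  have hI : b.ExteriorAlgebra I = ε • create (b x) (b.ExteriorAlgebra (I.erase x)) := by
    rw [h, smul_smul, Int.units_mul_self, one_smul]
  rw [hI, LinearMap.map_smul_of_tower, annihilate_create,
    annihilate_basis_of_notMem b (Finset.notMem_erase x I), map_zero, sub_zero, b.coord_apply,
    b.repr_self, Finsupp.single_eq_same, one_smul]

lemma create_basis_of_mem {x : ι} {I : Finset ι} (hx : x ∈ I) :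
    create (b x) (b.ExteriorAlgebra I) = 0 := by
  obtain ⟨ε, -, h⟩ := annihilate_basis_of_mem b hx
  rw [← smul_eq_zero_iff_eq ε, ← LinearMap.map_smul_of_tower, ← h, create_create_self]

lemma exteriorAction_basis_self (x : ι) (I : Finset ι) :
    exteriorAction (b x) (b.coord x) (b.ExteriorAlgebra I) =
      if x ∈ I then b.ExteriorAlgebra I else 0 := by
  rw [exteriorAction_apply]
  split_ifs with hx
  · obtain ⟨ε, h, h'⟩ := annihilate_basis_of_mem b hx
    rw [h, LinearMap.map_smul_of_tower, h', smul_smul, Int.units_mul_self, one_smul]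
  · rw [annihilate_basis_of_notMem b hx, map_zero]

lemma exteriorAction_basis_of_notMem (v : W) {t : ι} {I : Finset ι} (ht : t ∉ I) :
    exteriorAction v (b.coord t) (b.ExteriorAlgebra I) = 0 := by
  rw [exteriorAction_apply, annihilate_basis_of_notMem b ht, map_zero]

lemma exteriorAction_basis_of_mem {x t : ι} {I : Finset ι} (hx : x ∈ I) (hxt : x ≠ t) :
    exteriorAction (b x) (b.coord t) (b.ExteriorAlgebra I) = 0 := by
  by_cases ht : t ∈ I
  · obtain ⟨ε, h, -⟩ := annihilate_basis_of_mem b ht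
    rw [exteriorAction_apply, h, LinearMap.map_smul_of_tower,
      create_basis_of_mem b (Finset.mem_erase.mpr ⟨hxt, hx⟩), smul_zero]
  · exact exteriorAction_basis_of_notMem b _ ht

lemma exteriorAction_basis {x t : ι} {I : Finset ι} (hx : x ∉ I) (ht : t ∈ I) :
    ∃ ε : ℤˣ, exteriorAction (b x) (b.coord t) (b.ExteriorAlgebra I) =
      ε • b.ExteriorAlgebra (insert x (I.erase t)) := by
  obtain ⟨ε, h, -⟩ := annihilate_basis_of_mem b ht
  obtain ⟨δ, h'⟩ := create_basis b (mt Finset.mem_of_mem_erase hx : x ∉ I.erase t)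
  exact ⟨ε * δ, by rw [exteriorAction_apply, h, LinearMap.map_smul_of_tower, h', smul_smul]⟩

lemma toDual_create_basis (x : ι) (I J : Finset ι) :
    b.ExteriorAlgebra.toDual (create (b x) (b.ExteriorAlgebra I)) (b.ExteriorAlgebra J) =
      b.ExteriorAlgebra.toDual (b.ExteriorAlgebra I)
        (annihilate (b.coord x) (b.ExteriorAlgebra J)) := by
  have hleft : x ∉ I → insert x I ≠ J →
      b.ExteriorAlgebra.toDual (create (b x) (b.ExteriorAlgebra I)) (b.ExteriorAlgebra J) = 0 :=
    fun hI hIJ => by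
      obtain ⟨ε, h⟩ := create_basis b hI
      rw [h, LinearMap.map_smul_of_tower, LinearMap.smul_apply, Basis.toDual_apply, if_neg hIJ,
        smul_zero]
  by_cases hJ : x ∈ J
  · obtain ⟨ε, h, h'⟩ := annihilate_basis_of_mem b hJ
    rw [h, LinearMap.map_smul_of_tower, Basis.toDual_apply]
    by_cases hI : x ∈ I
    · rw [create_basis_of_mem b hI, map_zero, LinearMap.zero_apply, if_neg, smul_zero]
      rintro rfl
      exact Finset.notMem_erase x J hI
    · split_ifs with hIJ
      · rw [hIJ, h', LinearMap.map_smul_of_tower, LinearMap.smul_apply, Basis.toDual_apply,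
          if_pos rfl]
      · rw [smul_zero, hleft hI]
        rintro rfl
        exact hIJ (Finset.erase_insert hI).symm
  · rw [annihilate_basis_of_notMem b hJ, map_zero]
    by_cases hI : x ∈ I
    · rw [create_basis_of_mem b hI, map_zero, LinearMap.zero_apply]
    · refine hleft hI ?_
      rintro rfl
      exact hJ (Finset.mem_insert_self x I)

lemma toDual_create (x : ι) (u v : ExteriorAlgebra R W) :
    b.ExteriorAlgebra.toDual (create (b x) u) v =
      b.ExteriorAlgebra.toDual u (annihilate (b.coord x) v) := by
  suffices h : b.ExteriorAlgebra.toDual ∘ₗ create (b x) =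
      (b.ExteriorAlgebra.toDual).compl₂ (annihilate (b.coord x)) from LinearMap.congr_fun₂ h u v
  exact b.ExteriorAlgebra.ext fun I => b.ExteriorAlgebra.ext fun J => toDual_create_basis b x I J

lemma toDual_exteriorAction (x t : ι) (u v : ExteriorAlgebra R W) :
    b.ExteriorAlgebra.toDual (exteriorAction (b x) (b.coord t) u) v =
      b.ExteriorAlgebra.toDual u (exteriorAction (b t) (b.coord x) v) := by
  rw [exteriorAction_apply, exteriorAction_apply, toDual_create, toDual_comm, ← toDual_create,
    toDual_comm]

end MonomialBasis

section PrimitiveVectors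

variable {K W : Type*} [Field K] [AddCommGroup W] [Module K W] {m : ℕ}
  {b : Basis (Fin (2 * m)) K W} {z : ExteriorAlgebra K W}

lemma isRankOneAction_exteriorAction :
    IsRankOneAction (exteriorAction : W →ₗ[K] Dual K W →ₗ[K] End K (ExteriorAlgebra K W)) where
  commutator := exteriorAction_commutator
  sq_eq_zero _ _ := exteriorAction_mul_self

lemma toDual_rootAction (x t : Fin (2 * m)) (u v : ExteriorAlgebra K W) :
    b.ExteriorAlgebra.toDual (rootAction exteriorAction b x t u) v =
      b.ExteriorAlgebra.toDual u (rootAction exteriorAction b t x v) := by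
  simp only [rootAction, unitAction, LinearMap.sub_apply, LinearMap.smul_apply, map_sub, map_smul,
    toDual_exteriorAction, mul_comm (basisSign K t)]

lemma repr_rootAction (x t : Fin (2 * m)) (z : ExteriorAlgebra K W) (I : Finset (Fin (2 * m))) :
    b.ExteriorAlgebra.repr (rootAction exteriorAction b x t z) I =
      b.ExteriorAlgebra.toDual (rootAction exteriorAction b t x (b.ExteriorAlgebra I)) z := by
  rw [← Basis.toDual_apply_right, toDual_rootAction]

/-- The indices in `I` whose mirror images are not in `I`. -/
def unpaired (I : Finset (Fin (2 * m))) : Finset (Fin (2 * m)) := I.filter fun x => x.rev ∉ I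

lemma mem_unpaired {I : Finset (Fin (2 * m))} {x : Fin (2 * m)} :
    x ∈ unpaired I ↔ x ∈ I ∧ x.rev ∉ I := Finset.mem_filter

lemma repr_rootAction_self (x : Fin (2 * m)) (z : ExteriorAlgebra K W)
    (I : Finset (Fin (2 * m))) :
    b.ExteriorAlgebra.repr (rootAction exteriorAction b x x z) I =
      ((if x ∈ unpaired I then 1 else 0) - if x.rev ∈ unpaired I then 1 else 0) *
        b.ExteriorAlgebra.repr z I := by
  rw [repr_rootAction, rootAction_self, unitAction, unitAction, LinearMap.sub_apply,
    exteriorAction_basis_self, exteriorAction_basis_self, ← Basis.toDual_apply_right]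
  by_cases hx : x ∈ I <;> by_cases hx' : x.rev ∈ I <;> simp [mem_unpaired, hx, hx']

namespace IsPrimitive

variable {I J : Finset (Fin (2 * m))} {x t : Fin (2 * m)}

lemma toDual_rootAction_eq_zero (hz : IsPrimitive exteriorAction b z) (htx : t < x)
    (J : Finset (Fin (2 * m))) :
    b.ExteriorAlgebra.toDual (rootAction exteriorAction b t x (b.ExteriorAlgebra J)) z = 0 := by
  rw [← repr_rootAction, hz htx, map_zero, Finsupp.zero_apply]

lemma repr_eq_zero [CharZero K] (hz : IsPrimitive exteriorAction b z) (htx : t < x) (ht : t ∈ I)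
    (hx : x ∉ I) (hI : t.rev ∈ I → x.rev ∈ I) : b.ExteriorAlgebra.repr z I = 0 := by
  have hzero := hz.toDual_rootAction_eq_zero htx (insert x (I.erase t))
  obtain ⟨ε, hε⟩ := exteriorAction_basis b (x := t) (t := x) (I := insert x (I.erase t))
    (by simp [htx.ne]) (Finset.mem_insert_self _ _)
  rw [Finset.erase_insert (mt Finset.mem_of_mem_erase hx), Finset.insert_erase ht] at hε
  rw [← Basis.toDual_apply_right, ← smul_eq_zero_iff_eq ε, ← LinearMap.smul_apply,
    ← LinearMap.map_smul_of_tower, ← hε]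
  rw [rootAction, LinearMap.sub_apply, LinearMap.smul_apply, unitAction, unitAction] at hzero
  by_cases hxt : x = t.rev
  · subst hxt
    rw [Fin.rev_rev, basisSign_rev, mul_neg, basisSign_mul_self, neg_one_smul, sub_neg_eq_add,
      ← two_smul K, map_smul, LinearMap.smul_apply] at hzero
    exact (smul_eq_zero.mp hzero).resolve_left two_ne_zero
  · have hother : exteriorAction (b x.rev) (b.coord t.rev)
        (b.ExteriorAlgebra (insert x (I.erase t))) = 0 := by
      by_cases ht' : t.rev ∈ I
      · exact exteriorAction_basis_of_mem b (by simp [hI ht', Fin.rev_eq_iff, hxt])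
          (by simpa using htx.ne')
      · exact exteriorAction_basis_of_notMem b _ (by simp [ht', Ne.symm hxt])
    rwa [hother, smul_zero, sub_zero] at hzero

lemma isUpperSet_unpaired [CharZero K] (hz : IsPrimitive exteriorAction b z)
    (hI : b.ExteriorAlgebra.repr z I ≠ 0) : IsUpperSet (unpaired I : Set (Fin (2 * m))) := by
  intro t x htx ht
  rcases htx.eq_or_lt with rfl | htx
  · exact ht
  obtain ⟨htI, htI'⟩ := mem_unpaired.mp ht
  have hxI : x ∈ I := by
    by_contra hx
    exact hI (hz.repr_eq_zero htx htI hx fun h => absurd h htI')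
  refine mem_unpaired.mpr ⟨hxI, fun hx => hI ?_⟩
  exact hz.repr_eq_zero (Fin.rev_lt_rev.mpr htx) hx htI' fun _ => by rwa [Fin.rev_rev]

lemma rev_lt_of_mem_unpaired [CharZero K] (hz : IsPrimitive exteriorAction b z)
    (hI : b.ExteriorAlgebra.repr z I ≠ 0) (hx : x ∈ unpaired I) : x.rev < x := by
  refine lt_of_le_of_ne (le_of_not_gt fun h => ?_) (rev_ne x)
  exact (mem_unpaired.mp hx).2 (mem_unpaired.mp (hz.isUpperSet_unpaired hI h.le hx)).1

end IsPrimitive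

section PairSwap

variable {I J : Finset (Fin (2 * m))} {x t : Fin (2 * m)}

/-- The index set obtained from `I` by replacing the mirror pair of `t` by that of `x`. -/
def pairSwap (I : Finset (Fin (2 * m))) (t x : Fin (2 * m)) : Finset (Fin (2 * m)) :=
  I \ {t, t.rev} ∪ {x, x.rev}

lemma card_pairSwap (ht : t ∈ I) (ht' : t.rev ∈ I) (hx : x ∉ I) (hx' : x.rev ∉ I) :
    (pairSwap I t x).card = I.card := by
  have hsub : {t, t.rev} ⊆ I := Finset.insert_subset ht (Finset.singleton_subset_iff.mpr ht')
  have hdisj : Disjoint (I \ {t, t.rev}) {x, x.rev} := by simp [hx, hx']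
  have hle := Finset.card_le_card hsub
  rw [Finset.card_pair (rev_ne t).symm] at hle
  rw [pairSwap, Finset.card_union_of_disjoint hdisj, Finset.card_sdiff_of_subset hsub,
    Finset.card_pair (rev_ne t).symm, Finset.card_pair (rev_ne x).symm, Nat.sub_add_cancel hle]

lemma unpaired_pairSwap (ht : t ∈ I) (ht' : t.rev ∈ I) (hx : x ∉ I) (hx' : x.rev ∉ I) :
    unpaired (pairSwap I t x) = unpaired I := by
  ext y
  have h := Fin.rev_rev y
  have h1 := Fin.rev_rev x
  have h2 := Fin.rev_rev t
  simp only [mem_unpaired, pairSwap, Finset.mem_union, Finset.mem_sdiff, Finset.mem_insert,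
    Finset.mem_singleton]
  grind

lemma IsPrimitive.repr_pairSwap_sq_of_lt (hz : IsPrimitive exteriorAction b z) (htx : t < x)
    (ht : t ∈ I) (ht' : t.rev ∈ I) (hx : x ∉ I) (hx' : x.rev ∉ I) :
    b.ExteriorAlgebra.repr z (pairSwap I t x) ^ 2 = b.ExteriorAlgebra.repr z I ^ 2 := by
  have hxt : t.rev ≠ x := fun h => hx (h ▸ ht')
  have hzero := hz.toDual_rootAction_eq_zero htx (insert x (I.erase t))
  obtain ⟨ε, hε⟩ := exteriorAction_basis b (x := t) (t := x) (I := insert x (I.erase t))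
    (by simp [htx.ne]) (Finset.mem_insert_self _ _)
  obtain ⟨δ, hδ⟩ := exteriorAction_basis b (x := x.rev) (t := t.rev) (I := insert x (I.erase t))
    (by simp [hx', rev_ne]) (by simp [ht', rev_ne])
  have hswap : insert x.rev ((insert x (I.erase t)).erase t.rev) = pairSwap I t x := by
    ext y
    simp only [pairSwap, Finset.mem_union, Finset.mem_sdiff, Finset.mem_insert,
      Finset.mem_singleton, Finset.mem_erase]
    grind
  have hunit : ∀ ε : ℤˣ, ((ε : ℤ) : K) ^ 2 = 1 := fun ε => by
    rcases Int.units_eq_one_or ε with rfl | rfl <;> simp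
  rw [Finset.erase_insert (mt Finset.mem_of_mem_erase hx), Finset.insert_erase ht,
    Units.smul_def, ← Int.cast_smul_eq_zsmul K] at hε
  rw [hswap, Units.smul_def, ← Int.cast_smul_eq_zsmul K] at hδ
  simp only [rootAction, unitAction, LinearMap.sub_apply, LinearMap.smul_apply, hε, hδ, map_sub,
    map_smul, Basis.toDual_apply_right, smul_eq_mul, sub_eq_zero] at hzero
  have hsq := congrArg (· ^ 2) hzero
  simp only [mul_pow, hunit, sq (basisSign K _), basisSign_mul_self, one_mul] at hsq
  exact hsq.symm

lemma IsPrimitive.repr_pairSwap_sq (hz : IsPrimitive exteriorAction b z)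
    (ht : t ∈ I) (ht' : t.rev ∈ I) (hx : x ∉ I) (hx' : x.rev ∉ I) :
    b.ExteriorAlgebra.repr z (pairSwap I t x) ^ 2 = b.ExteriorAlgebra.repr z I ^ 2 := by
  rcases lt_or_gt_of_ne (ne_of_mem_of_not_mem ht hx) with h | h
  · exact hz.repr_pairSwap_sq_of_lt h ht ht' hx hx'
  · have hrev : pairSwap I t.rev x.rev = pairSwap I t x := by
      simp only [pairSwap, Fin.rev_rev, Finset.pair_comm]
    rw [← hrev]
    exact hz.repr_pairSwap_sq_of_lt (Fin.rev_lt_rev.mpr h) ht' (by rwa [Fin.rev_rev]) hx'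
      (by rwa [Fin.rev_rev])

lemma rev_mem_sdiff (h : unpaired I = unpaired J) (ht : t ∈ I \ J) : t.rev ∈ I \ J := by
  obtain ⟨htI, htJ⟩ := Finset.mem_sdiff.mp ht
  have hIJ : t ∉ unpaired I := fun h0 => htJ (mem_unpaired.mp (h ▸ h0)).1
  have hJI : t.rev ∉ unpaired J := fun h0 => by
    have := (mem_unpaired.mp (h.symm ▸ h0)).2
    rw [Fin.rev_rev] at this
    exact this htI
  rw [mem_unpaired] at hIJ hJI
  rw [Fin.rev_rev] at hJI
  exact Finset.mem_sdiff.mpr ⟨by_contra fun h0 => hIJ ⟨htI, h0⟩, fun h0 => hJI ⟨h0, htJ⟩⟩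

lemma IsPrimitive.repr_sq_eq_repr_sq (hz : IsPrimitive exteriorAction b z)
    (hIJ : unpaired I = unpaired J) (hcard : I.card = J.card) :
    b.ExteriorAlgebra.repr z I ^ 2 = b.ExteriorAlgebra.repr z J ^ 2 := by
  induction hd : (I \ J).card using Nat.strong_induction_on generalizing I with
  | _ d ih =>
    rcases (I \ J).eq_empty_or_nonempty with h0 | ⟨t, ht⟩
    · rw [Finset.eq_of_subset_of_card_le (Finset.sdiff_eq_empty_iff_subset.mp h0) hcard.ge]
    obtain ⟨x, hx⟩ : (J \ I).Nonempty := by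
      rw [← Finset.card_pos, ← Finset.card_sdiff_comm hcard]
      exact Finset.card_pos.mpr ⟨t, ht⟩
    have ht' := rev_mem_sdiff hIJ ht
    have hx' := rev_mem_sdiff hIJ.symm hx
    have hlt : (pairSwap I t x \ J).card < d := by
      rw [← hd]
      refine Finset.card_lt_card ⟨fun y hy => ?_, fun h => ?_⟩
      · simp only [pairSwap, Finset.mem_union, Finset.mem_sdiff, Finset.mem_insert,
          Finset.mem_singleton] at hy hx hx' ⊢
        grind
      · have := h ht
        simp only [pairSwap, Finset.mem_union, Finset.mem_sdiff, Finset.mem_insert,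
          Finset.mem_singleton] at this ht hx hx'
        grind
    rw [Finset.mem_sdiff] at ht ht' hx hx'
    rw [← hz.repr_pairSwap_sq ht.1 ht'.1 hx.2 hx'.2]
    exact ih _ hlt ((unpaired_pairSwap ht.1 ht'.1 hx.2 hx'.2).trans hIJ)
      ((card_pairSwap ht.1 ht'.1 hx.2 hx'.2).trans hcard) rfl

end PairSwap

section CasimirEigenvalue

variable {n : ℕ} {c : K} {z z' : ExteriorAlgebra K W} {I J : Finset (Fin (2 * m))}

lemma sum_indicator_sub_rev {S : Finset (Fin (2 * m))} (hS : ∀ x ∈ S, x.rev ∉ S)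
    {χ w : Fin (2 * m) → K} (hχ : ∀ x, χ x = if x ∈ S then 1 else 0)
    (hw : ∀ x, w x.rev = -w x) :
    ∑ x, ((χ x - χ x.rev) * (χ x - χ x.rev) + w x * (χ x - χ x.rev)) =
      ∑ x ∈ S, 2 * (1 + w x) := by
  have hsplit : ∀ x, (χ x - χ x.rev) * (χ x - χ x.rev) + w x * (χ x - χ x.rev) =
      χ x * (1 + w x) + χ x.rev * (1 + w x.rev) := fun x => by
    rw [hw, hχ, hχ]
    by_cases hx : x ∈ S
    · simp [hx, hS]
    · by_cases hx' : x.rev ∈ S <;> simp [hx, hx']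
  rw [Finset.sum_congr rfl fun x _ => hsplit x, Finset.sum_add_distrib]
  simp only [← Fin.revPerm_apply]
  rw [Equiv.sum_comp Fin.revPerm fun x => χ x * (1 + w x), ← two_mul, ← Finset.mul_sum]
  simp only [hχ, ite_mul, one_mul, zero_mul, Finset.sum_ite_mem, Finset.univ_inter]

lemma IsPrimitive.repr_sum_rootAction_rootAction [CharZero K]
    (hz : IsPrimitive exteriorAction b z) (hI : b.ExteriorAlgebra.repr z I ≠ 0) :
    b.ExteriorAlgebra.repr (∑ p : Fin (2 * m) × Fin (2 * m),
        rootAction exteriorAction b p.1 p.2 (rootAction exteriorAction b p.2 p.1 z)) I =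
      ((∑ x ∈ unpaired I, 2 * ((x : ℕ) - x.rev + 2) : ℕ) : K) * b.ExteriorAlgebra.repr z I := by
  let χ : Fin (2 * m) → K := fun x => if x ∈ unpaired I then 1 else 0
  let w : Fin (2 * m) → K := fun x => x - x.rev - basisSign K x
  have hw : ∀ x, w x.rev = -w x := fun x => by
    simp only [w, Fin.rev_rev, basisSign_rev]
    ring
  calc _ = (∑ x, ((χ x - χ x.rev) * (χ x - χ x.rev) + w x * (χ x - χ x.rev))) *
        b.ExteriorAlgebra.repr z I := by
        rw [hz.sum_rootAction_rootAction isRankOneAction_exteriorAction, map_sum,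
          Finsupp.finsetSum_apply, Finset.sum_mul]
        refine Finset.sum_congr rfl fun x _ => ?_
        rw [map_add, map_smul, Finsupp.add_apply, Finsupp.smul_apply, repr_rootAction_self,
          repr_rootAction_self, smul_eq_mul]
        ring
    _ = (∑ x ∈ unpaired I, 2 * (1 + w x)) * b.ExteriorAlgebra.repr z I := by
        rw [sum_indicator_sub_rev (fun x hx hx' => (mem_unpaired.mp hx).2 (mem_unpaired.mp hx').1)
          (fun _ => rfl) hw]
    _ = _ := by
        push_cast
        refine congrArg (· * _) (Finset.sum_congr rfl fun x hx => ?_)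
        have hlt := hz.rev_lt_of_mem_unpaired hI hx
        rw [Nat.cast_sub (Fin.le_def.mp hlt.le)]
        simp only [w, basisSign, hlt.not_gt, if_false]
        ring

/-- A primitive vector of degree `n` in the exterior algebra on which the unnormalised Casimir
operator of the symplectic Lie algebra takes the eigenvalue `c`. -/
structure IsCasimirPrimitive (b : Basis (Fin (2 * m)) K W) (n : ℕ) (c : K)
    (z : ExteriorAlgebra K W) : Prop where
  mem : z ∈ ⋀[K]^n W
  isPrimitive : IsPrimitive exteriorAction b z
  casimir : ∑ p : Fin (2 * m) × Fin (2 * m),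
    rootAction exteriorAction b p.1 p.2 (rootAction exteriorAction b p.2 p.1 z) = c • z

namespace IsCasimirPrimitive

lemma card_eq (hz : IsCasimirPrimitive b n c z) (hI : b.ExteriorAlgebra.repr z I ≠ 0) :
    I.card = n :=
  not_imp_comm.mp (repr_eq_zero_of_card_ne b hz.mem) hI

lemma eq_sum_unpaired [CharZero K] (hz : IsCasimirPrimitive b n c z)
    (hI : b.ExteriorAlgebra.repr z I ≠ 0) :
    c = ((∑ x ∈ unpaired I, 2 * ((x : ℕ) - x.rev + 2) : ℕ) : K) := by
  have h := hz.isPrimitive.repr_sum_rootAction_rootAction hI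
  rw [hz.casimir, map_smul, Finsupp.smul_apply, smul_eq_mul] at h
  exact mul_right_cancel₀ hI h

-- The unpaired sets are comparable, and the eigenvalue is strictly monotone in them.
lemma unpaired_eq [CharZero K] (hz : IsCasimirPrimitive b n c z)
    (hz' : IsCasimirPrimitive b n c z') (hI : b.ExteriorAlgebra.repr z I ≠ 0)
    (hJ : b.ExteriorAlgebra.repr z' J ≠ 0) : unpaired I = unpaired J := by
  have hc := Nat.cast_injective ((hz.eq_sum_unpaired hI).symm.trans (hz'.eq_sum_unpaired hJ))
  have hmono : ∀ S T : Finset (Fin (2 * m)), S ⊂ T →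
      ∑ x ∈ S, 2 * ((x : ℕ) - x.rev + 2) < ∑ x ∈ T, 2 * ((x : ℕ) - x.rev + 2) := fun S T hST => by
    obtain ⟨x, hxT, hxS⟩ := Finset.exists_of_ssubset hST
    exact Finset.sum_lt_sum_of_subset hST.subset hxT hxS (by positivity) fun _ _ _ => zero_le
  rcases (hz.isPrimitive.isUpperSet_unpaired hI).total
    (hz'.isPrimitive.isUpperSet_unpaired hJ) with h | h
  · exact by_contra fun hne => (hmono _ _ (Finset.ssubset_iff_subset_ne.mpr
      ⟨Finset.coe_subset.mp h, hne⟩)).ne hc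
  · exact by_contra fun hne => (hmono _ _ (Finset.ssubset_iff_subset_ne.mpr
      ⟨Finset.coe_subset.mp h, Ne.symm hne⟩)).ne hc.symm

lemma toDual_self_ne_zero [CharZero K] (hz : IsCasimirPrimitive b n c z) (h0 : z ≠ 0) :
    b.ExteriorAlgebra.toDual z z ≠ 0 := by
  obtain ⟨I, hI⟩ := DFunLike.ne_iff.mp (b.ExteriorAlgebra.repr.map_ne_zero_iff.mpr h0)
  have hsq : ∀ J ∈ (b.ExteriorAlgebra.repr z).support,
      b.ExteriorAlgebra.repr z J * b.ExteriorAlgebra.repr z J =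
        b.ExteriorAlgebra.repr z I ^ 2 := fun J hJ => by
    rw [Finsupp.mem_support_iff] at hJ
    rw [← sq]
    exact hz.isPrimitive.repr_sq_eq_repr_sq (hz.unpaired_eq hz hJ hI)
      ((hz.card_eq hJ).trans (hz.card_eq hI).symm)
  have hform : b.ExteriorAlgebra.toDual z z =
      (b.ExteriorAlgebra.repr z).support.card • b.ExteriorAlgebra.repr z I ^ 2 := by
    conv_lhs => arg 2; rw [← b.ExteriorAlgebra.linearCombination_repr z]
    rw [Finsupp.linearCombination_apply, Finsupp.sum, map_sum, ← Finset.sum_const,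
      ← Finset.sum_congr rfl hsq]
    refine Finset.sum_congr rfl fun J _ => ?_
    rw [map_smul, smul_eq_mul, Basis.toDual_apply_left]
  rw [hform]
  exact smul_ne_zero (Finset.card_ne_zero.mpr ⟨I, Finsupp.mem_support_iff.mpr hI⟩)
    (pow_ne_zero 2 hI)

lemma smul_sub_smul (hz : IsCasimirPrimitive b n c z) (hz' : IsCasimirPrimitive b n c z')
    (k k' : K) : IsCasimirPrimitive b n c (k • z - k' • z') where
  mem := sub_mem (Submodule.smul_mem _ _ hz.mem) (Submodule.smul_mem _ _ hz'.mem)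
  isPrimitive x t htx := by
    rw [map_sub, map_smul, map_smul, hz.isPrimitive htx, hz'.isPrimitive htx, smul_zero,
      smul_zero, sub_zero]
  casimir := by
    simp only [map_sub, map_smul, Finset.sum_sub_distrib, ← Finset.smul_sum, hz.casimir,
      hz'.casimir, smul_sub, smul_comm c]

lemma exists_smul_eq [CharZero K] (hz : IsCasimirPrimitive b n c z)
    (hz' : IsCasimirPrimitive b n c z') (h0 : z ≠ 0) : ∃ k : K, k • z = z' := by
  obtain ⟨I, hI⟩ := DFunLike.ne_iff.mp (b.ExteriorAlgebra.repr.map_ne_zero_iff.mpr h0)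
  let y := b.ExteriorAlgebra.repr z' I • z - b.ExteriorAlgebra.repr z I • z'
  have hy : IsCasimirPrimitive b n c y := hz.smul_sub_smul hz' _ _
  have hyI : b.ExteriorAlgebra.repr y I = 0 := by
    simp only [y, map_sub, map_smul, Finsupp.sub_apply, Finsupp.smul_apply, smul_eq_mul]
    ring
  have hy0 : y = 0 := b.ExteriorAlgebra.ext_elem fun J => by
    rw [map_zero, Finsupp.zero_apply]
    by_contra hJ
    have hsq := hy.isPrimitive.repr_sq_eq_repr_sq (hz.unpaired_eq hy hI hJ)
      ((hz.card_eq hI).trans (hy.card_eq hJ).symm)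
    rw [hyI, sq, zero_mul] at hsq
    exact hJ (pow_eq_zero_iff two_ne_zero |>.mp hsq.symm)
  refine ⟨(b.ExteriorAlgebra.repr z I)⁻¹ * b.ExteriorAlgebra.repr z' I, ?_⟩
  rw [mul_smul, sub_eq_zero.mp hy0, smul_smul, inv_mul_cancel₀ hI, one_smul]

end IsCasimirPrimitive

end CasimirEigenvalue

end PrimitiveVectors

section ExteriorPower

variable {K W : Type*} [Field K] [AddCommGroup W] [Module K W] {m n : ℕ}
  {b : Basis (Fin (2 * m)) K W} {Q : LinearMap.BilinForm K W}

lemma isRankOneAction_exteriorPowerAction :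
    IsRankOneAction (exteriorPowerAction n : W →ₗ[K] Dual K W →ₗ[K] End K (⋀[K]^n W)) where
  commutator v φ w ψ := LinearMap.ext fun z => Subtype.ext <|
    LinearMap.congr_fun (exteriorAction_commutator v φ w ψ) (z : ExteriorAlgebra K W)
  sq_eq_zero _ _ h := LinearMap.ext fun z => Subtype.ext <|
    LinearMap.congr_fun (exteriorAction_mul_self h) (z : ExteriorAlgebra K W)

lemma rootAction_exteriorPowerAction_coe (x t : Fin (2 * m)) (z : ⋀[K]^n W) :
    (rootAction (exteriorPowerAction n) b x t z : ExteriorAlgebra K W) =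
      rootAction exteriorAction b x t z := rfl

/-- The bilinear form on an exterior power for which the monomials in the basis `b` are
orthonormal. -/
noncomputable def monomialForm (b : Basis (Fin (2 * m)) K W) (n : ℕ) :
    LinearMap.BilinForm K (⋀[K]^n W) :=
  b.ExteriorAlgebra.toDual.domRestrict₁₂ (⋀[K]^n W) (⋀[K]^n W)

lemma monomialForm_apply (y z : ⋀[K]^n W) :
    monomialForm b n y z = b.ExteriorAlgebra.toDual (y : ExteriorAlgebra K W) z := rfl

lemma monomialForm_isRefl : (monomialForm b n).IsRefl := fun y z h => by
  rwa [monomialForm_apply, toDual_comm]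

lemma monomialForm_rootAction (x t : Fin (2 * m)) (y z : ⋀[K]^n W) :
    monomialForm b n (rootAction (exteriorPowerAction n) b x t y) z =
      monomialForm b n y (rootAction (exteriorPowerAction n) b t x z) :=
  toDual_rootAction x t _ _

namespace IsSymplecticFamily

lemma exists_monomialForm_adjoint_mem [CharZero K] [FiniteDimensional K W]
    (hb : IsSymplecticFamily Q b) (hQ : Q.IsAlt) {X : End K (⋀[K]^n W)}
    (hX : X ∈ symplecticAlgebra (exteriorPowerAction n) Q) :
    ∃ X' ∈ symplecticAlgebra (exteriorPowerAction n) Q,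
      ∀ y z, monomialForm b n (X' y) z = monomialForm b n y (X z) := by
  obtain ⟨c, -, hdual⟩ := hb.exists_isTraceDual_rootAction
    (isRankOneAction_exteriorPowerAction (n := n)) hQ
  refine ⟨∑ p : Fin (2 * m) × Fin (2 * m),
    trace K _ (X * c • rootAction (exteriorPowerAction n) b p.2 p.1) •
      rootAction (exteriorPowerAction n) b p.2 p.1,
    sum_mem fun p _ => Submodule.smul_mem _ _ (hb.rootAction_mem _ _), fun y z => ?_⟩
  conv_rhs => rw [← hdual.sum_left X hX]
  simp only [LinearMap.sum_apply, LinearMap.smul_apply, map_sum, map_smul,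
    monomialForm_rootAction]

variable [IsAlgClosed K] [CharZero K] [FiniteDimensional K W]

lemma exists_isCasimirPrimitive_mem (hb : IsSymplecticFamily Q b) {c k : K} (hc : c ≠ 0)
    {M : Submodule K (⋀[K]^n W)}
    (hM : IsSimple (symplecticAlgebra (exteriorPowerAction n) Q) M)
    (hk : ∀ z ∈ M, casimir
      (fun p : Fin (2 * m) × Fin (2 * m) => rootAction (exteriorPowerAction n) b p.1 p.2)
      (fun p => c • rootAction (exteriorPowerAction n) b p.2 p.1) z = k • z) :
    ∃ z ∈ M, z ≠ 0 ∧ IsCasimirPrimitive b n (c⁻¹ * k) (z : ExteriorAlgebra K W) := by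
  obtain ⟨z, hzM, hz, hprim⟩ :=
    hb.exists_isPrimitive_mem isRankOneAction_exteriorPowerAction hM.prop.2 hM.prop.1
  refine ⟨z, hzM, hz, z.2, fun x t htx => ?_, ?_⟩
  · rw [← rootAction_exteriorPowerAction_coe, hprim htx, Submodule.coe_zero]
  · have hcas := hk z hzM
    simp only [casimir, mul_smul_comm, ← Finset.smul_sum, LinearMap.smul_apply,
      LinearMap.sum_apply, End.mul_apply] at hcas
    rw [mul_smul, eq_inv_smul_iff₀ hc]
    simpa only [Submodule.coe_smul, Submodule.coe_sum, rootAction_exteriorPowerAction_coe] using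
      congrArg ((↑) : ⋀[K]^n W → ExteriorAlgebra K W) hcas

lemma isCompletelyReducible_exteriorPower (hb : IsSymplecticFamily Q b) (hQ : Q.IsAlt) :
    IsCompletelyReducible (symplecticAlgebra (exteriorPowerAction n) Q) := by
  have hD : IsRankOneAction (exteriorPowerAction n : W →ₗ[K] _) :=
    isRankOneAction_exteriorPowerAction
  obtain ⟨c, hc, hdual⟩ := hb.exists_isTraceDual_rootAction hD hQ
  refine isCompletelyReducible_of_bilinForm monomialForm_isRefl
    (fun X => hb.exists_monomialForm_adjoint_mem hQ) fun M hM => ?_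
  obtain ⟨k, hk⟩ := hdual.exists_casimir_eq_smul (hD.bracket_mem hQ) hM
  obtain ⟨z, hzM, hz, hprim⟩ := hb.exists_isCasimirPrimitive_mem hc hM hk
  exact ⟨z, hzM, hprim.toDual_self_ne_zero (Submodule.coe_eq_zero.not.mpr hz)⟩

lemma separatesSimple_casimir (hb : IsSymplecticFamily Q b) {c : K} (hc : c ≠ 0) :
    SeparatesSimple (symplecticAlgebra (exteriorPowerAction n) Q) (casimir
      (fun p : Fin (2 * m) × Fin (2 * m) => rootAction (exteriorPowerAction n) b p.1 p.2)
      (fun p => c • rootAction (exteriorPowerAction n) b p.2 p.1)) :=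
  fun M N hM hN k hkM hkN => by
    obtain ⟨z, hzM, hz, hprim⟩ := hb.exists_isCasimirPrimitive_mem hc hM hkM
    obtain ⟨z', hzN, hz', hprim'⟩ := hb.exists_isCasimirPrimitive_mem hc hN hkN
    obtain ⟨a, ha⟩ := hprim.exists_smul_eq hprim' (Submodule.coe_eq_zero.not.mpr hz)
    have haz : a • z = z' := Subtype.ext ha
    exact hM.eq_of_inf_ne_bot hN ((Submodule.ne_bot_iff _).mpr
      ⟨z', ⟨haz ▸ M.smul_mem a hzM, hzN⟩, hz'⟩)

end IsSymplecticFamily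

end ExteriorPower

section IsometryImage

variable {K W : Type*} [Field K] [AddCommGroup W] [Module K W] {n : ℕ}
  {Q : LinearMap.BilinForm K W}

/-- The image of the isometry group of `Q` in the endomorphisms of the `n`-th exterior power. -/
def isometryImage (Q : LinearMap.BilinForm K W) (n : ℕ) : Set (End K (⋀[K]^n W)) :=
  {T | ∃ h : W ≃ₗ[K] W, (∀ x y, Q (h x) (h y) = Q x y) ∧
    exteriorPower.map n (h : W →ₗ[K] W) = T}

lemma map_sqAction {h : W ≃ₗ[K] W} (hh : ∀ x y, Q (h x) (h y) = Q x y) (v : W)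
    (z : ⋀[K]^n W) :
    exteriorPower.map n (h : W →ₗ[K] W) (sqAction (exteriorPowerAction n) Q v z) =
      sqAction (exteriorPowerAction n) Q (h v) (exteriorPower.map n (h : W →ₗ[K] W) z) := by
  have hcomp : Q (h v) ∘ₗ (h : W →ₗ[K] W) = Q v := LinearMap.ext (hh v)
  refine Subtype.ext ?_
  rw [sqAction, sqAction, exteriorPower_map_coe, exteriorPowerAction_coe, exteriorPowerAction_coe,
    exteriorPower_map_coe, ← hcomp, map_exteriorAction, LinearEquiv.coe_coe]

lemma one_add_sqAction_mem_isometryImage (hQ : Q.IsAlt) (v : W) :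
    1 + sqAction (exteriorPowerAction n) Q v ∈ isometryImage Q n := by
  refine ⟨LinearEquiv.transvection (hQ v), fun x y => ?_, LinearMap.ext fun z => Subtype.ext ?_⟩
  · simp only [LinearEquiv.transvection.apply, map_add, map_smul, LinearMap.add_apply,
      LinearMap.smul_apply, smul_eq_mul, hQ v, ← hQ.neg_eq v x]
    ring
  · rw [LinearEquiv.transvection.coe_toLinearMap, exteriorPower_map_coe, map_transvection]
    rfl

lemma isInvariant_symplecticAlgebra (hQ : Q.IsAlt) {U : Submodule K (⋀[K]^n W)}
    (hU : ∀ T ∈ isometryImage Q n, U ∈ T.invtSubmodule) :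
    IsInvariant (symplecticAlgebra (exteriorPowerAction n) Q) U := by
  refine isInvariant_span ?_
  rintro _ ⟨v, rfl⟩ z hz
  have hmem := hU _ (one_add_sqAction_mem_isometryImage hQ v) hz
  exact (U.add_mem_iff_right hz).mp hmem

lemma normalizes_of_mem_isometryImage {e : ⋀[K]^n W ≃ₗ[K] ⋀[K]^n W}
    (he : (e : End K (⋀[K]^n W)) ∈ isometryImage Q n) :
    Normalizes e (symplecticAlgebra (exteriorPowerAction n) Q) := by
  obtain ⟨h, hh, hhe⟩ := he
  have hconj : ∀ v, e.conj (sqAction (exteriorPowerAction n) Q v) =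
      sqAction (exteriorPowerAction n) Q (h v) := fun v => LinearMap.ext fun z => by
    rw [LinearEquiv.conj_apply_apply, ← LinearEquiv.coe_coe e, ← hhe, map_sqAction hh, hhe,
      LinearEquiv.coe_coe, e.apply_symm_apply]
  refine normalizes_span ?_ ?_
  · rintro _ ⟨v, rfl⟩
    rw [hconj]
    exact sqAction_mem _
  · rintro _ ⟨v, rfl⟩
    rw [← h.apply_symm_apply v, ← hconj]
    exact (e.conj.symm_apply_apply _).symm ▸ sqAction_mem (h.symm v)

variable [IsAlgClosed K] [CharZero K] [FiniteDimensional K W] {g : ⋀[K]^n W ≃ₗ[K] ⋀[K]^n W}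

/- The conjugate `1 + Y` of the transvection `1 + X` acts through an isometry, hence normalizes
the symplectic Lie algebra, and this forces the square-zero operator `Y` into it. -/
lemma conj_sqAction_mem (hQ : Q.Nondegenerate) (hQalt : Q.IsAlt)
    (hg : Set.MapsTo g.conj (isometryImage Q n) (isometryImage Q n)) (v : W) :
    g.conj (sqAction (exteriorPowerAction n) Q v) ∈
      symplecticAlgebra (exteriorPowerAction n) Q := by
  obtain ⟨m, b, hb⟩ := exists_symplecticBasis hQ hQalt
  have hD : IsRankOneAction (exteriorPowerAction n : W →ₗ[K] _) :=
    isRankOneAction_exteriorPowerAction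
  obtain ⟨c, hc, hdual⟩ := hb.exists_isTraceDual_rootAction hD hQalt
  set Y := g.conj (sqAction (exteriorPowerAction n) Q v) with hYdef
  have hY : Y * Y = 0 := by
    rw [Module.End.mul_eq_comp, hYdef, ← g.conj_comp, ← Module.End.mul_eq_comp, sqAction,
      hD.sq_eq_zero _ _ (hQalt v), map_zero]
  obtain ⟨e, he⟩ := exists_linearEquiv_eq_one_add hY
  refine mem_of_normalizes (hb.isCompletelyReducible_exteriorPower hQalt) hdual
    (hD.bracket_mem hQalt) (hb.separatesSimple_casimir hc)
    (hD.symplecticAlgebra_le_span_nilpotent hQalt) hY (fun z => LinearMap.congr_fun he z)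
    (normalizes_of_mem_isometryImage ?_)
  have hmem := hg (one_add_sqAction_mem_isometryImage hQalt v)
  rwa [map_add, show g.conj 1 = 1 from g.conj_id, ← hYdef, ← he] at hmem

lemma normalizes_symplecticAlgebra (hQ : Q.Nondegenerate) (hQalt : Q.IsAlt)
    (hg : g.conj '' isometryImage Q n = isometryImage Q n) :
    Normalizes g (symplecticAlgebra (exteriorPowerAction n) Q) := by
  have hmaps : Set.MapsTo g.conj (isometryImage Q n) (isometryImage Q n) :=
    Set.mapsTo_iff_image_subset.mpr hg.le
  have hmaps_symm : Set.MapsTo g.symm.conj (isometryImage Q n) (isometryImage Q n) :=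
    fun T hT => by
      rw [← hg] at hT
      obtain ⟨S, hS, rfl⟩ := hT
      exact (g.conj.symm_apply_apply S).symm ▸ hS
  refine normalizes_span ?_ ?_
  · rintro _ ⟨v, rfl⟩
    exact conj_sqAction_mem hQ hQalt hmaps v
  · rintro _ ⟨v, rfl⟩
    exact conj_sqAction_mem hQ hQalt hmaps_symm v

end IsometryImage

lemma conj_image_isometryImage {W : Type*} [AddCommGroup W] [Module ℂ W]
    {Q : LinearMap.BilinForm ℂ W} {n : ℕ} {g : ⋀[ℂ]^n W ≃ₗ[ℂ] ⋀[ℂ]^n W}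
    (hg : g ∈ Subgroup.normalizer
      ((symplecticSubgroup Q).map (exteriorPowerRep W n) : Set (⋀[ℂ]^n W ≃ₗ[ℂ] ⋀[ℂ]^n W))) :
    g.conj '' isometryImage Q n = isometryImage Q n := by
  refine Set.Subset.antisymm ?_ ?_
  · rintro _ ⟨_, ⟨h, hh, rfl⟩, rfl⟩
    obtain ⟨h', hh', heq⟩ := (Subgroup.mem_normalizer_iff.mp hg (exteriorPowerRep W n h)).mp
      ⟨h, hh, rfl⟩
    exact ⟨h', hh', congrArg LinearEquiv.toLinearMap heq⟩
  · rintro _ ⟨h, hh, rfl⟩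
    obtain ⟨h', hh', heq⟩ := (Subgroup.mem_normalizer_iff''.mp hg (exteriorPowerRep W n h)).mp
      ⟨h, hh, rfl⟩
    exact ⟨_, ⟨h', hh', congrArg LinearEquiv.toLinearMap heq⟩, g.conj.apply_symm_apply _⟩

end SymplecticExterior

open SymplecticExterior in
theorem mainTheorem11_general {K W : Type*} [Field K] [IsAlgClosed K] [CharZero K]
    [AddCommGroup W] [Module K W] [FiniteDimensional K W] {Q : LinearMap.BilinForm K W}
    (hQ : Q.Nondegenerate) (hQalt : Q.IsAlt) {n : ℕ} {g : ⋀[K]^n W ≃ₗ[K] ⋀[K]^n W}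
    (hg : g.conj '' isometryImage Q n = isometryImage Q n) {U : Submodule K (⋀[K]^n W)}
    (hU : ∀ T ∈ isometryImage Q n, U ∈ T.invtSubmodule) :
    U.map (g : ⋀[K]^n W →ₗ[K] ⋀[K]^n W) = U := by
  obtain ⟨m, b, hb⟩ := exists_symplecticBasis hQ hQalt
  have hD : IsRankOneAction (exteriorPowerAction n : W →ₗ[K] _) :=
    isRankOneAction_exteriorPowerAction
  obtain ⟨c, hc, hdual⟩ := hb.exists_isTraceDual_rootAction hD hQalt
  exact (isInvariant_symplecticAlgebra hQalt hU).map_eq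
    (hb.isCompletelyReducible_exteriorPower hQalt) hdual (hD.bracket_mem hQalt)
    (hb.separatesSimple_casimir hc) (normalizes_symplecticAlgebra hQ hQalt hg)

theorem mainTheorem11 {W : Type*} [AddCommGroup W] [Module ℂ W] [FiniteDimensional ℂ W]
    (Q : LinearMap.BilinForm ℂ W) (hQ : Q.Nondegenerate) (hQalt : Q.IsAlt)
    (n : ℕ) (hn : n + 1 ≤ Module.finrank ℂ W)
    (g : ⋀[ℂ]^n W ≃ₗ[ℂ] ⋀[ℂ]^n W)
    (hg : g ∈ Subgroup.normalizer
      ((symplecticSubgroup Q).map (exteriorPowerRep W n) : Set (⋀[ℂ]^n W ≃ₗ[ℂ] ⋀[ℂ]^n W)))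
    (U : Submodule ℂ (⋀[ℂ]^n W))
    (hU : ∀ h ∈ symplecticSubgroup Q, ∀ u ∈ U, exteriorPowerRep W n h u ∈ U) :
    U.map (g : ⋀[ℂ]^n W →ₗ[ℂ] ⋀[ℂ]^n W) = U := by
  exact mainTheorem11_general hQ hQalt (SymplecticExterior.conj_image_isometryImage hg)
    (by rintro _ ⟨h, hh, rfl⟩; exact hU h hh)
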